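/- **Setting.** Let $e>0$, $m=e/\sqrt\pi$, $\omega(p)=\sqrt{p^2+m^2}$, and let $\mathcal F$ be the bosonic Fock space over $L^2(\mathbb R)$, with vacuum $\Omega$. Let $$\phi(x)=\int\frac{dp}{\sqrt{2\pi}}\frac{1}{\sqrt{2\omega(p)}}\bigl(a(p)e^{ipx}+a^*(p)e^{-ipx}\bigr),\qquad \pi(x)=\int\frac{dp}{\sqrt{2\pi}}\,i\sqrt{\tfrac{\omega(p)}{2}}\bigl(a^*(p)e^{-ipx}-a(p)e^{ipx}\bigr)$$ be the free field of mass $m$ and its conjugate momentum at time zero (so $[\phi(x),\pi(y)]=i\delta(x-y)$); the smeared operators $\phi(f)=\int f\phi$, $\pi(g)=\int g\pi$ are self-adjoint. Let $$H=\int\omega(p)\,a^*(p)a(p)\,dp=\tfrac12\int dx\;{:}\bigl[\pi^2+(\nabla\phi)^2+m^2\phi^2\bigr](x){:}$$ be the generator of time translations. Fix $\varepsilon>0$ and, for every $R>0$, a real $C^1$ function $g_{R,\varepsilon}$ on $\mathbb R$ with $g_{R,\varepsilon}=1$ on $[0,R]$ and $g_{R,\varepsilon}(x)=0$ for $x\le-\varepsilon$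 and for $x\ge R+\varepsilon$. Define the dipole states $$\Psi_{R,\varepsilon}=e^{i\sqrt\pi\,\pi(g_{R,\varepsilon})}\,\Omega,\qquad \omega_{R,\varepsilon}(A)=\langle\Psi_{R,\varepsilon},A\,\Psi_{R,\varepsilon}\rangle ,\quad A\in\mathfrak A,$$ where $\mathfrak A$ is the C*-algebra generated by $e^{i\phi(f)}$ and $e^{i\pi(g)}$, with $f,g$ in the space $\mathcal S^0_{\mathbb R}$ of real Schwartz functions whose Fourier transform vanishes at the origin. *Charge.* The electric field is $F_{01}=-(e/\sqrt\pi)\,\phi$, and Gauss' law $\partial_xF_{01}=e\,j^0$ gives the charge density $j^0=-\tfrac1{\sqrt\pi}\partial_x\phi$; its smearing with $h$ is $Q_h=\int h\,j^0=\tfrac1{\sqrt\pi}\phi(h')$, and $e^{isQ_h}\in\mathfrak A$. A state $\omega$ on $\mathfrak A$ has charge $q$ if for every sequence of real functions $h_n\in C_c^\infty(\mathbb R)$ such that on every bounded interval $h_n=1$ for all large $n$, and such that $\int (h_n')^2\,dx\to0$, one has $$\lim_{n\to\infty}\omega\bigl(A^*e^{isQ_{h_n}}B\bigr)=e^{isq}\,\omega(A^*B)\qquad\text{for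 all } A,B\in\mathfrak A,\ s\in\mathbb R,$$ i.e. in the GNS representation of $\omega$ the charge operator $\lim_n Q_{h_n}$ (strong resolvent limit) exists and equals $q\cdot\mathbf 1$. **Proposition.** (a) For every $R>0$, $\Psi_{R,\varepsilon}$ is in the quadratic form domain of $H$ and $$\langle\Psi_{R,\varepsilon},H\Psi_{R,\varepsilon}\rangle=\frac{\pi}{2}\int_{-\infty}^{\infty}\Bigl(g_{R,\varepsilon}'(x)^2+\frac{e^2}{\pi}\,g_{R,\varepsilon}(x)^2\Bigr)dx .$$ The left side may be computed either with the quadratic form of $\int\omega\,a^*a\,dp$ or as the integral over $x$ of the expectation of the Wick-ordered energy density $\tfrac12{:}[\pi^2+(\nabla\phi)^2+m^2\phi^2](x){:}$, where Wick squares are defined by smearing the fields with an approximate delta function at $x$, subtracting the vacuum expectation of the square, and removing the smearing. (b) The family $(\omega_{R,\varepsilon})$ has at least one weak-* limit point $\omega_\varepsilon$ as $R\to\infty$, and every such limit point is a state on $\mathfrak A$ with charge $1$. -/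

import Mathlib

open MeasureTheory Filter Topology
open scoped ENNReal FourierTransform SchwartzMap

namespace Schwinger

noncomputable section

/-! ### Bosonic Fock space over the one-particle space `L²(ℝ)` -/

/-- One-particle space: square-integrable wave functions of the variable `ξ`, where the momentum is
`p = 2πξ` (so that the Fourier transform `𝓕` of Mathlib is unitary). -/
abbrev OneParticle : Type := Lp ℂ 2 (volume : Measure ℝ)

/-- All (not necessarily symmetric) wave functions of `n` particles. -/
abbrev Sector (n : ℕ) : Type := Lp ℂ 2 (volume : Measure (Fin n → ℝ))

/-- Hilbert direct sum of the spaces `L²(ℝⁿ)`, `n = 0, 1, 2, …`. -/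
abbrev FullFock : Type := lp Sector 2

lemma memLp_tensorPow (h : OneParticle) (n : ℕ) :
    MemLp (fun k : Fin n → ℝ => ∏ j, h (k j)) 2 volume := by
  have hm : AEStronglyMeasurable (fun k : Fin n → ℝ => ∏ j, h (k j)) volume := by
    refine Finset.aestronglyMeasurable_fun_prod _ (fun j _ => ?_)
    exact (Lp.aestronglyMeasurable h).comp_quasiMeasurePreserving
      (Measure.quasiMeasurePreserving_eval (fun _ : Fin n => (volume : Measure ℝ)) j)
  rw [memLp_two_iff_integrable_sq_norm hm]
  have hh : Integrable (fun x => ‖h x‖ ^ 2) (volume : Measure ℝ) :=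
    (memLp_two_iff_integrable_sq_norm (Lp.aestronglyMeasurable h)).1 (Lp.memLp h)
  have := Integrable.fintype_prod (ι := Fin n) (f := fun _ x => ‖h x‖ ^ 2)
    (μ := fun _ => (volume : Measure ℝ)) (fun _ => hh)
  rw [← volume_pi] at this
  simpa [norm_prod, Finset.prod_pow] using this

/-- The `n`-fold tensor power `h ⊗ ⋯ ⊗ h`, i.e. `(k₁, …, kₙ) ↦ h(k₁) ⋯ h(kₙ)`. -/
def tensorPow (h : OneParticle) (n : ℕ) : Sector n := (memLp_tensorPow h n).toLp _

/-- The bosonic Fock space `⨁ₙ Symⁿ L²(ℝ)`. The symmetric tensor power `Symⁿ` is the closed linear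
span of the powers `h ⊗ ⋯ ⊗ h`; by polarization these are exactly the permutation-symmetric
elements of `L²(ℝⁿ)`. -/
def bosonFock : Submodule ℂ FullFock :=
  (Submodule.span ℂ
    {ψ : FullFock | ∃ (n : ℕ) (h : OneParticle), ψ = lp.single 2 n (tensorPow h n)}).topologicalClosure

/-- The bosonic Fock space as a Hilbert space. -/
def Fock : Type := bosonFock

instance : NormedAddCommGroup Fock := inferInstanceAs (NormedAddCommGroup bosonFock)

instance : InnerProductSpace ℂ Fock := inferInstanceAs (InnerProductSpace ℂ bosonFock)

instance : CompleteSpace Fock :=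
  inferInstanceAs (CompleteSpace (Submodule.topologicalClosure _ : Submodule ℂ FullFock))

/-- The `n`-particle wave function of a Fock space vector. -/
def wave (ψ : Fock) (n : ℕ) : (Fin n → ℝ) → ℂ := (ψ.1 n : Sector n)

/-- The Fock vacuum `Ω = (1, 0, 0, …)`. -/
def vacuum : Fock :=
  ⟨lp.single 2 0 (tensorPow 0 0),
    Submodule.le_topologicalClosure _ (Submodule.subset_span ⟨0, 0, rfl⟩)⟩

/-! ### Annihilation, creation and field operators -/

/-- `(a(h)ψ)ₙ(k₁,…,kₙ) = √(n+1) ∫ conj(h(p)) ψₙ₊₁(p,k₁,…,kₙ) dp`. -/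
def annihilate (h : OneParticle) (ψ : Fock) (n : ℕ) (k : Fin n → ℝ) : ℂ :=
  (Real.sqrt (n + 1) : ℂ) * ∫ p : ℝ, (starRingEnd ℂ) (h p) * wave ψ (n + 1) (Fin.cons p k)

/-- `(a*(h)ψ)ₙ(k₁,…,kₙ) = n^{-1/2} ∑ⱼ h(kⱼ) ψₙ₋₁(k₁,…,k̂ⱼ,…,kₙ)`, and `(a*(h)ψ)₀ = 0`. -/
def create (h : OneParticle) (ψ : Fock) : (n : ℕ) → (Fin n → ℝ) → ℂ
  | 0, _ => 0
  | n + 1, k => ((Real.sqrt (n + 1))⁻¹ : ℂ) *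
      ∑ j : Fin (n + 1), h (k j) * wave ψ n (fun i => k (j.succAbove i))

/-- The graph of the self-adjoint field operator `Φ(h) = a(h) + a*(h)` on its natural (maximal)
domain: `ψ ∈ D(Φ(h))` and `Φ(h)ψ = χ`. -/
def IsField (h : OneParticle) (ψ χ : Fock) : Prop :=
  ∀ n : ℕ, ∀ᵐ k : Fin n → ℝ, wave χ n k = annihilate h ψ n k + create h ψ n k

/-- `U` is the strongly continuous unitary group `t ↦ exp(itA)` generated by the operator with
graph `A`. -/
structure IsUnitaryGroupOf (A : Fock → Fock → Prop) (U : ℝ → Fock →L[ℂ] Fock) : Prop where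
  unitary_mem : ∀ t, U t ∈ unitary (Fock →L[ℂ] Fock)
  zero : U 0 = 1
  add : ∀ s t, U (s + t) = U s * U t
  cont : ∀ ψ, Continuous fun t => U t ψ
  deriv_zero : ∀ ψ χ, A ψ χ → HasDerivAt (fun t => U t ψ) (Complex.I • χ) 0

open Classical in
/-- `exp(itA)` for a self-adjoint operator with graph `A` (the group exists and is unique by Stone's
theorem; the value `1` is used only if there is no such group). -/
def expI (A : Fock → Fock → Prop) (t : ℝ) : Fock →L[ℂ] Fock :=
  if h : ∃ U : ℝ → Fock →L[ℂ] Fock, IsUnitaryGroupOf A U then h.choose t else 1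

/-! ### The free field of mass `m` at time zero -/

/-- The one-particle energy `ω(p) = √(p² + m²)` at `p = 2πξ`. -/
def freq (m ξ : ℝ) : ℝ := Real.sqrt ((2 * Real.pi * ξ) ^ 2 + m ^ 2)

/-- The Fourier transform of a real function. -/
def hat (f : ℝ → ℝ) : ℝ → ℂ := 𝓕 fun x => (f x : ℂ)

open Classical in
/-- The `L²` class of a square-integrable function (and `0` for other functions). -/
def toL2 (u : ℝ → ℂ) : OneParticle := if h : MemLp u 2 volume then h.toLp u else 0

/-- One-particle vector of `φ(f)`: `f̂ / √(2ω)`. -/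
def phiVec (m : ℝ) (f : ℝ → ℝ) : OneParticle :=
  toL2 fun ξ => hat f ξ / (Real.sqrt (2 * freq m ξ) : ℂ)

/-- One-particle vector of `π(g)`: `i √(ω/2) ĝ`. -/
def piVec (m : ℝ) (g : ℝ → ℝ) : OneParticle :=
  toL2 fun ξ => Complex.I * (Real.sqrt (freq m ξ / 2) : ℂ) * hat g ξ

/-- Graph of the smeared field
`φ(f) = ∫ dξ (2ω)^{-1/2} (conj f̂(ξ) a(ξ) + f̂(ξ) a*(ξ))`. -/
def phi (m : ℝ) (f : ℝ → ℝ) : Fock → Fock → Prop := IsField (phiVec m f)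

/-- Graph of the smeared conjugate momentum
`π(g) = ∫ dξ i (ω/2)^{1/2} (ĝ(ξ) a*(ξ) - conj ĝ(ξ) a(ξ))`, so that `[φ(f), π(g)] = i ∫ f g`. -/
def mom (m : ℝ) (g : ℝ → ℝ) : Fock → Fock → Prop := IsField (piVec m g)

/-! ### The Hamiltonian -/

/-- The closed quadratic form `⟨ψ, Hψ⟩ ∈ [0, ∞]` of the generator `H` of time translations in Fock
space: `H` multiplies the `n`-particle wave function by `ω(k₁) + ⋯ + ω(kₙ)`. The value is finite
exactly on the quadratic form domain of `H`. -/
def energyForm (m : ℝ) (ψ : Fock) : ℝ≥0∞ :=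
  ∑' n : ℕ, ∫⁻ k : Fin n → ℝ, ENNReal.ofReal (∑ j, freq m (k j)) * ‖wave ψ n k‖ₑ ^ 2

/-- `r = ⟨ψ, :A²: ψ⟩ = ⟨Aψ, Aψ⟩ - ⟨AΩ, AΩ⟩` for a field operator with graph `A`; both vectors are
required to be in the domain of `A`. -/
def HasWickSquare (A : Fock → Fock → Prop) (ψ : Fock) (r : ℝ) : Prop :=
  ∃ χ χ₀ : Fock, A ψ χ ∧ A vacuum χ₀ ∧ r = ‖χ‖ ^ 2 - ‖χ₀‖ ^ 2

/-- The approximate delta function `y ↦ δ⁻¹ ρ((y - x)/δ)` at `x`. -/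
def bump (ρ : ℝ → ℝ) (δ x y : ℝ) : ℝ := δ⁻¹ * ρ ((y - x) / δ)

/-- `E` is the expectation, in the state of the vector `ψ`, of the Wick-ordered energy density
`½ :[π² + (∇φ)² + m² φ²]:(x)`: the fields are smeared with an approximate delta function at `x`
(with `(∇φ)(f) = -φ(f')`), the vacuum expectation is subtracted, and the smearing is removed. -/
def HasEnergyDensity (m : ℝ) (ψ : Fock) (x E : ℝ) : Prop :=
  ∀ ρ : ℝ → ℝ, ContDiff ℝ (⊤ : ℕ∞) ρ → HasCompactSupport ρ → ∫ y, ρ y = 1 →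
    ∃ a b c : ℝ → ℝ,
      (∀ δ > 0, HasWickSquare (mom m (bump ρ δ x)) ψ (a δ) ∧
        HasWickSquare (phi m (fun y => -deriv (bump ρ δ x) y)) ψ (b δ) ∧
        HasWickSquare (phi m (bump ρ δ x)) ψ (c δ)) ∧
      Tendsto (fun δ => 1 / 2 * (a δ + b δ + m ^ 2 * c δ)) (𝓝[>] 0) (𝓝 E)

/-! ### Dipole states -/

/-- `g` is a real `C¹` function with `g = 1` on `[0, R]` and `g = 0` outside `(-ε, R + ε)`. -/
structure IsDipoleProfile (ε R : ℝ) (g : ℝ → ℝ) : Prop where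
  contDiff : ContDiff ℝ 1 g
  eq_one : ∀ x, 0 ≤ x → x ≤ R → g x = 1
  eq_zero : ∀ x, x ≤ -ε ∨ R + ε ≤ x → g x = 0

/-- The dipole vector `exp(i √π π(g)) Ω`. -/
def dipole (m : ℝ) (g : ℝ → ℝ) : Fock := expI (mom m g) (Real.sqrt Real.pi) vacuum

/-! ### The Weyl algebra and its states -/

/-- Real Schwartz functions whose Fourier transform vanishes at the origin. -/
def SZero : Type := {f : 𝓢(ℝ, ℝ) // hat f 0 = 0}

/-- `exp(i φ(f))`. -/
def weylPhi (m : ℝ) (f : SZero) : Fock →L[ℂ] Fock := expI (phi m f.1) 1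

/-- `exp(i π(g))`. -/
def weylPi (m : ℝ) (g : SZero) : Fock →L[ℂ] Fock := expI (mom m g.1) 1

/-- The Weyl algebra: the C*-algebra generated by `exp(i φ(f))`, `exp(i π(g))`, `f, g ∈ SZero`. -/
def weylAlgebra (m : ℝ) : StarSubalgebra ℂ (Fock →L[ℂ] Fock) :=
  (StarAlgebra.adjoin ℂ (Set.range (weylPhi m) ∪ Set.range (weylPi m))).topologicalClosure

/-- The functional `A ↦ ⟨ψ, A ψ⟩` on the Weyl algebra, as an element of the weak-* dual. -/
def vectorState (m : ℝ) (ψ : Fock) : WeakDual ℂ (weylAlgebra m) :=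
  StrongDual.toWeakDual
    (((innerSL ℂ ψ).comp (ContinuousLinearMap.apply ℂ Fock ψ)).comp
      (weylAlgebra m).toSubalgebra.toSubmodule.subtypeL)

/-- Positive normalized functionals. -/
def IsState {m : ℝ} (ω : WeakDual ℂ (weylAlgebra m)) : Prop :=
  ω 1 = 1 ∧ ∀ A : weylAlgebra m, ∃ r : ℝ, 0 ≤ r ∧ ω (star A * A) = r

/-! ### The electric charge -/

lemma hat_smul_deriv_zero (c : ℝ) (h : 𝓢(ℝ, ℝ)) :
    hat (c • SchwartzMap.derivCLM ℝ ℝ h : 𝓢(ℝ, ℝ)) 0 = 0 := by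
  have h0 : ∫ x, deriv h x = 0 := by
    refine integral_eq_zero_of_hasDerivAt_of_integrable (f := h)
      (fun x => h.differentiableAt.hasDerivAt) ?_ h.integrable
    exact (SchwartzMap.derivCLM ℝ ℝ h).integrable
  have : hat (c • SchwartzMap.derivCLM ℝ ℝ h : 𝓢(ℝ, ℝ)) 0
      = ∫ x, ((c * deriv h x : ℝ) : ℂ) := by
    simp [hat, Real.fourier_eq]
  rw [this, integral_complex_ofReal, integral_const_mul, h0]
  simp

/-- The test function `c h'`, which is in `SZero`. -/
def derivTest (c : ℝ) (h : 𝓢(ℝ, ℝ)) : SZero :=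
  ⟨c • SchwartzMap.derivCLM ℝ ℝ h, hat_smul_deriv_zero c h⟩

/-- `exp(i s Q_h)` as an element of the Weyl algebra, where `Q_h = ∫ h j⁰` is the charge smeared
with the spatial cutoff `h`. The charge density is `j⁰ = -(1/√π) ∂ₓφ`: this is Gauss' law
`∂ₓ F₀₁ = e j⁰` for the electric field `F₀₁ = -(e/√π) φ`. Hence `Q_h = (1/√π) φ(h')`. -/
def expCharge (m s : ℝ) (h : 𝓢(ℝ, ℝ)) : weylAlgebra m :=
  ⟨weylPhi m (derivTest (s / Real.sqrt Real.pi) h),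
    StarSubalgebra.le_topologicalClosure _
      (StarAlgebra.subset_adjoin ℂ _ (Or.inl ⟨_, rfl⟩))⟩

/-- Spatial cutoffs tending to `1`: smooth with compact support, eventually equal to `1` on every
bounded interval, with slopes that vanish in the limit (for example `hₙ(x) = χ(x/(n+1))` with `χ`
smooth of compact support and equal to `1` near `0`). -/
structure IsChargeCutoff (h : ℕ → 𝓢(ℝ, ℝ)) : Prop where
  compact : ∀ n, HasCompactSupport (h n)
  eq_one : ∀ r : ℝ, ∀ᶠ n in atTop, ∀ x : ℝ, |x| ≤ r → h n x = 1
  slope : Tendsto (fun n => ∫ x, (deriv (h n) x) ^ 2) atTop (𝓝 0)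

/-- The functional `ω` has charge `q`: in its GNS representation the smeared charges `Q_h` converge,
as `h → 1`, to `q` times the identity, in the sense that `exp(i s Q_h) → exp(i s q)` for every real
`s`. The numbers `ω(A* X B)` are the matrix elements of `X` between the dense set of vectors `A Ω_ω`,
`B Ω_ω`; for unitaries weak convergence to a unitary is strong convergence, and strong convergence of
the unitary groups is convergence of the generators `Q_h` in the strong resolvent sense. -/
def HasCharge {m : ℝ} (ω : WeakDual ℂ (weylAlgebra m)) (q : ℝ) : Prop :=
  ∀ h : ℕ → 𝓢(ℝ, ℝ), IsChargeCutoff h → ∀ (s : ℝ) (A B : weylAlgebra m),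
    Tendsto (fun n => ω (star A * expCharge m s (h n) * B)) atTop
      (𝓝 (Complex.exp (Complex.I * s * q) * ω (star A * B)))

end

end Schwinger

open Schwinger

open MeasureTheory Filter Topology
open scoped ENNReal FourierTransform SchwartzMap

namespace Schwinger

noncomputable section

open scoped ComplexInnerProductSpace

/-! ### Tensor products of one-particle vectors -/

/-! Everything reduces to explicit computation with coherent vectors. The vector `coherent f`, with
components `f ⊗ ⋯ ⊗ f / √n!`, has Gram kernel `exp ⟪f, g⟫`, and coherent vectors are total.
Translation `f ↦ f + h`, with the right scalar factor, preserves this kernel, so it defines an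
isometry `weyl h`; the Weyl relations can be checked on coherent vectors. The abstract exponential
`expI` of a field operator on its maximal domain is identified with `weyl` by `expI_isField`:
existence rests on symmetry of the maximal operator against coherent vectors
(`IsField.inner_coherent`), uniqueness on constancy of `U (-s) (weylGroup h s (coherent f))`. A
dipole state is therefore a normalized coherent state with one-particle vector `f = i√π piVec m g`.

Energy: the form of `H` in that state is `∫ ω |f|²` (`energyForm_smul_coherent`). Since `|piVec|² =
(ω/2)|ĝ|²` and `ω² = p² + m²`, Plancherel turns this into the stated integral, whose finiteness puts
the state in the form domain. For the density, the Wick square of a field in a coherent state is the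
square of its expectation (`hasWickSquare_weyl_vacuum`). This is zero for `π` and `π (∫ u g)²` for
`φ(u)`; removing the smearing gives the density pointwise.

Charge: `exp(i s Q_h)` is the Weyl operator of a vector whose norm is controlled, thanks to the
mass, by the `L²` norm of `h'`. As the slopes vanish it asymptotically commutes in norm with the
whole algebra (`asympCommutes_of_mem`) and fixes the vacuum in the limit. On a dipole with `R`
beyond the support of `h` only the left end of the profile is seen, and the Weyl relation yields the
phase `exp(i s)` with an error independent of `R` (`norm_expCharge_dipole`). So the estimate
survives any limit point in `R`, and then `n → ∞` (`hasCharge_of_mapClusterPt`). -/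

lemma ae_comp_eval {n : ℕ} (j : Fin n) {u v : ℝ → ℂ} (h : u =ᵐ[volume] v) :
    (fun k : Fin n → ℝ => u (k j)) =ᵐ[volume] fun k => v (k j) :=
  (Measure.quasiMeasurePreserving_eval (fun _ : Fin n => (volume : Measure ℝ)) j).ae_eq_comp h

lemma memLp_tensor {n : ℕ} (f : Fin n → OneParticle) :
    MemLp (fun k : Fin n → ℝ => ∏ j, f j (k j)) 2 volume := by
  have hm : AEStronglyMeasurable (fun k : Fin n → ℝ => ∏ j, f j (k j)) volume := by
    refine Finset.aestronglyMeasurable_fun_prod _ (fun j _ => ?_)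
    exact (Lp.aestronglyMeasurable (f j)).comp_quasiMeasurePreserving
      (Measure.quasiMeasurePreserving_eval (fun _ : Fin n => (volume : Measure ℝ)) j)
  rw [memLp_two_iff_integrable_sq_norm hm]
  have := Integrable.fintype_prod (ι := Fin n) (f := fun j x => ‖f j x‖ ^ 2)
    (μ := fun _ => (volume : Measure ℝ)) (fun j =>
      (memLp_two_iff_integrable_sq_norm (Lp.aestronglyMeasurable (f j))).1 (Lp.memLp (f j)))
  rw [← volume_pi] at this
  simpa [norm_prod, Finset.prod_pow] using this

/-- The tensor product `f₁ ⊗ ⋯ ⊗ fₙ`. -/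
def tensor {n : ℕ} (f : Fin n → OneParticle) : Sector n := (memLp_tensor f).toLp _

lemma coeFn_tensor {n : ℕ} (f : Fin n → OneParticle) :
    tensor f =ᵐ[volume] fun k => ∏ j, f j (k j) := MemLp.coeFn_toLp _

lemma tensorPow_eq_tensor (h : OneParticle) (n : ℕ) :
    tensorPow h n = tensor fun _ : Fin n => h := rfl

lemma inner_tensor {n : ℕ} (f g : Fin n → OneParticle) :
    ⟪tensor f, tensor g⟫ = ∏ j, ⟪f j, g j⟫ := by
  simp only [L2.inner_def]
  rw [← integral_fintype_prod_volume_eq_prod (fun j x => ⟪f j x, g j x⟫)]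
  refine integral_congr_ae ?_
  filter_upwards [coeFn_tensor f, coeFn_tensor g] with k hf hg
  simp [hf, hg, Finset.prod_mul_distrib, map_prod]

lemma norm_tensor {n : ℕ} (f : Fin n → OneParticle) : ‖tensor f‖ = ∏ j, ‖f j‖ := by
  have h := inner_tensor f f
  simp only [inner_self_eq_norm_sq_to_K] at h
  have h' : ‖tensor f‖ ^ 2 = (∏ j, ‖f j‖) ^ 2 := by
    rw [← Finset.prod_pow]; exact_mod_cast h
  exact (sq_eq_sq₀ (norm_nonneg _) (by positivity)).1 h'

lemma tensor_update_ae {n : ℕ} (f : Fin n → OneParticle) (j : Fin n) (h : OneParticle) :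
    tensor (Function.update f j h) =ᵐ[volume]
      fun k => h (k j) * ∏ i ∈ Finset.univ.erase j, f i (k i) := by
  filter_upwards [coeFn_tensor (Function.update f j h)] with k hk
  rw [hk, ← Finset.mul_prod_erase _ _ (Finset.mem_univ j)]
  congr 1
  · simp
  · exact Finset.prod_congr rfl fun i hi => by
      rw [Function.update_of_ne (Finset.ne_of_mem_erase hi)]

/-- The tensor product as a continuous multilinear map. -/
def tensorMap (n : ℕ) : ContinuousMultilinearMap ℂ (fun _ : Fin n => OneParticle) (Sector n) :=
  MultilinearMap.mkContinuous
    { toFun := tensor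
      map_update_add' := by
        intro dec f j x y
        -- The multilinearity field quantifies over every `DecidableEq` instance; it is replaced by
        -- the canonical one so that `tensor_update_ae` matches.
        cases Subsingleton.elim dec (fun a b => instDecidableEqFin n a b)
        refine Lp.ext ?_
        filter_upwards [tensor_update_ae f j x, tensor_update_ae f j y,
          tensor_update_ae f j (x + y), Lp.coeFn_add (tensor (Function.update f j x))
            (tensor (Function.update f j y)), ae_comp_eval j (Lp.coeFn_add x y)]
          with k h1 h2 h3 h4 h5
        refine Eq.trans ?_ h4.symm
        rw [h3, Pi.add_apply, h1, h2, h5, Pi.add_apply, add_mul]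
      map_update_smul' := by
        intro dec f j c x
        cases Subsingleton.elim dec (fun a b => instDecidableEqFin n a b)
        refine Lp.ext ?_
        filter_upwards [tensor_update_ae f j x, tensor_update_ae f j (c • x),
          Lp.coeFn_smul c (tensor (Function.update f j x)), ae_comp_eval j (Lp.coeFn_smul c x)]
          with k h1 h2 h3 h4
        refine Eq.trans ?_ h3.symm
        rw [h2, Pi.smul_apply, h1, h4, Pi.smul_apply, smul_eq_mul, smul_eq_mul, mul_assoc] }
    1 (fun f => by
      rw [one_mul]
      exact (norm_tensor f).le)

lemma tensorMap_apply {n : ℕ} (f : Fin n → OneParticle) : tensorMap n f = tensor f := rfl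

/-- `∑ⱼ f ⊗ ⋯ ⊗ h ⊗ ⋯ ⊗ f` with `h` in position `j`. -/
def tensorInsert (h f : OneParticle) (n : ℕ) : Sector n :=
  ∑ j : Fin n, tensor (Function.update (fun _ => f) j h)

/-- The product rule for the continuous multilinear tensor map. It makes the creation operator a
derivative of coherent vectors, which later gives both its symmetry and its inner products. -/
lemma hasDerivAt_tensorPow (h f : OneParticle) (n : ℕ) (z : ℂ) :
    HasDerivAt (fun z : ℂ => tensorPow (f + z • h) n) (tensorInsert h (f + z • h) n) z := by
  have h1 : HasDerivAt (fun z : ℂ => (fun _ : Fin n => f + z • h)) (fun _ => h) z := by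
    refine hasDerivAt_pi.2 fun j => ?_
    simpa using ((hasDerivAt_id z).smul_const h).const_add f
  have h2 := ((tensorMap n).hasFDerivAt (fun _ : Fin n => f + z • h)).comp_hasDerivAt z h1
  simpa [tensorInsert, tensorMap_apply, Function.comp_def, tensorPow_eq_tensor] using h2

lemma norm_tensorPow (f : OneParticle) (n : ℕ) : ‖tensorPow f n‖ = ‖f‖ ^ n := by
  simp [tensorPow_eq_tensor, norm_tensor]

lemma norm_tensorInsert_le (h f : OneParticle) (n : ℕ) :
    ‖tensorInsert h f n‖ ≤ n * (‖h‖ * ‖f‖ ^ (n - 1)) := by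
  have : ∀ j ∈ (Finset.univ : Finset (Fin n)),
      ‖tensor (Function.update (fun _ => f) j h)‖ ≤ ‖h‖ * ‖f‖ ^ (n - 1) := by
    intro j _
    rw [norm_tensor, ← Finset.mul_prod_erase _ _ (Finset.mem_univ j),
      Finset.prod_congr rfl (g := fun _ => ‖f‖) fun i hi => by
        rw [Function.update_of_ne (Finset.ne_of_mem_erase hi)]]
    simp
  calc ‖tensorInsert h f n‖ ≤ ∑ j : Fin n, ‖h‖ * ‖f‖ ^ (n - 1) := norm_sum_le_of_le _ this
    _ = _ := by simp

/-! ### Coherent vectors -/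

lemma summable_pow_div_sqrt_factorial (r : ℝ) :
    Summable fun n : ℕ => r ^ n * (Real.sqrt n.factorial)⁻¹ := by
  rcases eq_or_ne r 0 with rfl | hr
  · refine summable_of_hasFiniteSupport ((Set.finite_singleton 0).subset fun n hn => ?_)
    by_contra h
    simp_all
  refine summable_of_ratio_test_tendsto_lt_one (l := 0) one_pos
    (Eventually.of_forall fun n => by positivity) ?_
  have : ∀ n : ℕ, ‖r ^ (n + 1) * (Real.sqrt (n + 1).factorial)⁻¹‖ /
      ‖r ^ n * (Real.sqrt n.factorial)⁻¹‖ = |r| * (Real.sqrt ((n : ℝ) + 1))⁻¹ := by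
    intro n
    have h0 : (0 : ℝ) < Real.sqrt n.factorial := Real.sqrt_pos.2 (by positivity)
    rw [Nat.factorial_succ, Nat.cast_mul, Real.sqrt_mul (by positivity)]
    simp only [norm_mul, norm_inv, norm_pow, Real.norm_eq_abs, abs_of_nonneg (Real.sqrt_nonneg _)]
    push_cast
    have h1 : (0 : ℝ) < Real.sqrt ((n : ℝ) + 1) := Real.sqrt_pos.2 (by positivity)
    have h2 : 0 < |r| := abs_pos.2 hr
    rw [pow_succ]
    field_simp
  simp_rw [this]
  have h3 : Tendsto (fun n : ℕ => (Real.sqrt ((n : ℝ) + 1))⁻¹) atTop (𝓝 0) := by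
    refine (Real.tendsto_sqrt_atTop.comp ?_).inv_tendsto_atTop
    exact tendsto_atTop_add_const_right _ _ tendsto_natCast_atTop_atTop
  simpa using h3.const_mul |r|

/-- `1 / √n!`. -/
def coeffFact (n : ℕ) : ℂ := ((Real.sqrt n.factorial)⁻¹ : ℝ)

lemma norm_coeffFact (n : ℕ) : ‖coeffFact n‖ = (Real.sqrt n.factorial)⁻¹ := by
  rw [coeffFact, Complex.norm_real, Real.norm_of_nonneg (by positivity)]

lemma coeffFact_ne_zero (n : ℕ) : coeffFact n ≠ 0 := by
  rw [← norm_pos_iff, norm_coeffFact]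
  exact inv_pos.2 (Real.sqrt_pos.2 (by positivity))

lemma conj_coeffFact (n : ℕ) : (starRingEnd ℂ) (coeffFact n) = coeffFact n := by
  simp [coeffFact]

lemma coeffFact_mul_self (n : ℕ) : coeffFact n * coeffFact n = ((n.factorial : ℂ))⁻¹ := by
  rw [coeffFact, ← Complex.ofReal_mul, ← mul_inv, Real.mul_self_sqrt (by positivity)]
  simp

/-- The `n`-particle component of a coherent vector. -/
def coherentTerm (f : OneParticle) (n : ℕ) : FullFock :=
  lp.single 2 n (coeffFact n • tensorPow f n)

/-- The `n`-particle component of `a*(h)` applied to a coherent vector. -/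
def creationTerm (h f : OneParticle) (n : ℕ) : FullFock :=
  lp.single 2 n (coeffFact n • tensorInsert h f n)

lemma norm_coherentTerm (f : OneParticle) (n : ℕ) :
    ‖coherentTerm f n‖ = ‖f‖ ^ n * (Real.sqrt n.factorial)⁻¹ := by
  rw [coherentTerm, lp.norm_single (by norm_num), norm_smul, norm_tensorPow, norm_coeffFact, mul_comm]

lemma summable_coherentTerm (f : OneParticle) : Summable (coherentTerm f) := by
  refine Summable.of_norm ?_
  simp_rw [norm_coherentTerm]
  exact summable_pow_div_sqrt_factorial _

/-- The factor `n` is absorbed by `2 ^ n`, and `1 ≤ r` absorbs the exponent `n - 1`. Uniformity over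
`‖f‖ ≤ r` is what termwise differentiation of the coherent series requires. -/
lemma norm_creationTerm_le {h f : OneParticle} {r : ℝ} (hr : 1 ≤ r) (hf : ‖f‖ ≤ r) (n : ℕ) :
    ‖creationTerm h f n‖ ≤ ‖h‖ * ((2 * r) ^ n * (Real.sqrt n.factorial)⁻¹) := by
  rw [creationTerm, lp.norm_single (by norm_num), norm_smul, norm_coeffFact]
  have h1 : (n : ℝ) ≤ 2 ^ n := by exact_mod_cast (Nat.lt_two_pow_self (n := n)).le
  have h2 : ‖f‖ ^ (n - 1) ≤ r ^ n :=
    (pow_le_pow_left₀ (norm_nonneg _) hf _).trans (pow_le_pow_right₀ hr (Nat.sub_le _ _))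
  have h3 : ‖tensorInsert h f n‖ ≤ ‖h‖ * (2 * r) ^ n := by
    refine (norm_tensorInsert_le h f n).trans ?_
    rw [mul_pow, mul_left_comm]
    gcongr
  calc (Real.sqrt n.factorial)⁻¹ * ‖tensorInsert h f n‖
      ≤ (Real.sqrt n.factorial)⁻¹ * (‖h‖ * (2 * r) ^ n) := by gcongr
    _ = _ := by ring

lemma summable_creationTerm (h f : OneParticle) : Summable (creationTerm h f) := by
  refine Summable.of_norm_bounded
    ((summable_pow_div_sqrt_factorial (2 * (‖f‖ + 1))).mul_left ‖h‖)
    (norm_creationTerm_le (by linarith [norm_nonneg f]) (by linarith))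

lemma hasDerivAt_coherentTerm (h f : OneParticle) (n : ℕ) (z : ℂ) :
    HasDerivAt (fun z : ℂ => coherentTerm (f + z • h) n) (creationTerm h (f + z • h) n) z :=
  (lp.singleContinuousLinearMap ℂ Sector 2 n).hasFDerivAt.comp_hasDerivAt z
    ((hasDerivAt_tensorPow h f n z).const_smul (coeffFact n))

lemma hasDerivAt_tsum_coherentTerm (h f : OneParticle) :
    HasDerivAt (fun z : ℂ => ∑' n, coherentTerm (f + z • h) n) (∑' n, creationTerm h f n) 0 := by
  have hb : ∀ (n : ℕ) (z : ℂ), z ∈ Metric.ball (0 : ℂ) 1 → ‖creationTerm h (f + z • h) n‖ ≤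
      ‖h‖ * ((2 * (‖f‖ + ‖h‖ + 1)) ^ n * (Real.sqrt n.factorial)⁻¹) := by
    intro n z hz
    refine norm_creationTerm_le (by linarith [norm_nonneg f, norm_nonneg h]) ?_ n
    have hz' : ‖z‖ ≤ 1 := by simpa using (Metric.mem_ball.1 hz).le
    calc ‖f + z • h‖ ≤ ‖f‖ + ‖z‖ * ‖h‖ := (norm_add_le _ _).trans (by rw [norm_smul])
      _ ≤ ‖f‖ + 1 * ‖h‖ := by gcongr
      _ ≤ _ := by linarith
  have := hasDerivAt_tsum_of_isPreconnected
    ((summable_pow_div_sqrt_factorial (2 * (‖f‖ + ‖h‖ + 1))).mul_left ‖h‖) Metric.isOpen_ball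
    (convex_ball (0 : ℂ) 1).isPreconnected (fun n z _ => hasDerivAt_coherentTerm h f n z) hb
    (Metric.mem_ball_self one_pos) (summable_coherentTerm _) (Metric.mem_ball_self one_pos)
  simpa using this

lemma single_smul_tensorPow_mem (f : OneParticle) (n : ℕ) (c : ℂ) :
    lp.single 2 n (c • tensorPow f n) ∈ bosonFock := by
  rw [lp.single_smul]
  exact Submodule.smul_mem _ _ (Submodule.le_topologicalClosure _
    (Submodule.subset_span ⟨n, f, rfl⟩))

lemma isClosed_bosonFock : IsClosed (bosonFock : Set FullFock) :=
  Submodule.isClosed_topologicalClosure _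

lemma tsum_mem_bosonFock {x : ℕ → FullFock} (hx : ∀ n, x n ∈ bosonFock) (hs : Summable x) :
    ∑' n, x n ∈ bosonFock :=
  isClosed_bosonFock.mem_of_tendsto hs.hasSum
    (Eventually.of_forall fun _ => Submodule.sum_mem _ fun n _ => hx n)

/-- The coherent vector with components `f ⊗ ⋯ ⊗ f / √n!`. -/
def coherent (f : OneParticle) : Fock :=
  ⟨∑' n, coherentTerm f n,
    tsum_mem_bosonFock (fun n => single_smul_tensorPow_mem f n _) (summable_coherentTerm f)⟩

/-- Difference quotients stay in the closed subspace. This places `creation h f` in the bosonic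
space without any explicit symmetrization. -/
lemma hasDerivAt_mem {E : Type*} [NormedAddCommGroup E] [NormedSpace ℂ E] {V : Submodule ℂ E}
    (hV : IsClosed (V : Set E)) {f : ℂ → E} {f' : E} {z : ℂ} (hf : ∀ z, f z ∈ V)
    (h : HasDerivAt f f' z) : f' ∈ V :=
  hV.mem_of_tendsto (hasDerivAt_iff_tendsto_slope.1 h) (Eventually.of_forall fun w => by
    rw [slope_def_module]
    exact V.smul_mem _ (V.sub_mem (hf _) (hf _)))

/-- The creation operator `a*(h)` applied to the coherent vector of `f`. -/
def creation (h f : OneParticle) : Fock :=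
  ⟨∑' n, creationTerm h f n,
    hasDerivAt_mem isClosed_bosonFock (fun z => (coherent (f + z • h)).2)
      (hasDerivAt_tsum_coherentTerm h f)⟩

/-- The inclusion of the bosonic Fock space in the full Fock space. -/
def fockIncl : Fock →ₗᵢ[ℂ] FullFock := bosonFock.subtypeₗᵢ

lemma hasDerivAt_coherent (h f : OneParticle) :
    HasDerivAt (fun z : ℂ => coherent (f + z • h)) (creation h f) 0 := by
  have h1 := hasDerivAt_tsum_coherentTerm h f
  rw [hasDerivAt_iff_isLittleO] at h1 ⊢
  rw [← Asymptotics.isLittleO_norm_left] at h1 ⊢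
  refine h1.congr_left fun z => ?_
  rw [← fockIncl.norm_map]
  simp only [map_sub, map_smul]
  rfl

lemma lp_tsum_single_apply {G : ℕ → Type*} [∀ i, NormedAddCommGroup (G i)]
    [∀ i, NormedSpace ℂ (G i)] (x : ∀ n, G n)
    (hs : Summable fun n => (lp.single 2 n (x n) : lp G 2)) (n : ℕ) :
    (∑' n, (lp.single 2 n (x n) : lp G 2) : lp G 2) n = x n := by
  have h1 := (lp.evalCLM ℂ G 2 n).hasSum hs.hasSum
  have h2 : ∀ i ≠ n, (lp.evalCLM ℂ G 2 n) (lp.single 2 i (x i)) = 0 := fun i hi =>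
    lp.single_apply_ne 2 i (x i) hi.symm
  refine (h1.unique (hasSum_single n h2)).trans ?_
  exact lp.single_apply_self 2 n (x n)

lemma coherent_apply (f : OneParticle) (n : ℕ) :
    (coherent f).1 n = coeffFact n • tensorPow f n :=
  lp_tsum_single_apply _ (summable_coherentTerm f) n

lemma creation_apply (h f : OneParticle) (n : ℕ) :
    (creation h f).1 n = coeffFact n • tensorInsert h f n :=
  lp_tsum_single_apply _ (summable_creationTerm h f) n

lemma hasSum_inner_fock (ψ χ : Fock) : HasSum (fun n => ⟪ψ.1 n, χ.1 n⟫) ⟪ψ, χ⟫ :=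
  lp.hasSum_inner ψ.1 χ.1

lemma inner_coherent (f g : OneParticle) :
    ⟪coherent f, coherent g⟫ = Complex.exp ⟪f, g⟫ := by
  refine (hasSum_inner_fock _ _).unique ?_
  have : ∀ n, ⟪(coherent f).1 n, (coherent g).1 n⟫ = (n.factorial : ℂ)⁻¹ • ⟪f, g⟫ ^ n := by
    intro n
    rw [coherent_apply, coherent_apply, inner_smul_left, inner_smul_right, conj_coeffFact,
      ← mul_assoc, coeffFact_mul_self, tensorPow_eq_tensor, tensorPow_eq_tensor, inner_tensor]
    simp
  simp_rw [this, Complex.exp_eq_exp_ℂ]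
  exact NormedSpace.exp_series_hasSum_exp' _

lemma inner_coherent_left_hasSum (f : OneParticle) (ψ : Fock) (z : ℂ) :
    HasSum (fun n => z ^ n * (coeffFact n * ⟪ψ.1 n, tensorPow f n⟫)) ⟪ψ, coherent (z • f)⟫ := by
  convert hasSum_inner_fock ψ (coherent (z • f)) using 2 with n
  have : tensorPow (z • f) n = z ^ n • tensorPow f n := by
    have := (tensorMap n).map_smul_univ (fun _ => z) (fun _ => f)
    simpa [tensorMap_apply, tensorPow_eq_tensor] using this
  rw [coherent_apply, this, inner_smul_right, inner_smul_right]
  ring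

/-- The closed orthogonal complement of `ψ` contains the generators of the bosonic space, hence
contains `ψ` itself. -/
lemma eq_zero_of_inner_tensorPow {ψ : Fock} (h : ∀ n f, ⟪ψ.1 n, tensorPow f n⟫ = 0) : ψ = 0 := by
  have h1 : bosonFock ≤ (ℂ ∙ ψ.1)ᗮ := by
    refine Submodule.topologicalClosure_minimal _ (Submodule.span_le.2 ?_)
      (Submodule.isClosed_orthogonal _)
    rintro _ ⟨n, f, rfl⟩
    rw [SetLike.mem_coe, Submodule.mem_orthogonal_singleton_iff_inner_right,
      lp.inner_single_right, h]
  have h2 := Submodule.mem_orthogonal_singleton_iff_inner_right.1 (h1 ψ.2)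
  exact Subtype.ext (inner_self_eq_zero.1 h2)

/-- Coherent vectors are total in the Fock space. -/
lemma eq_zero_of_inner_coherent {ψ : Fock} (h : ∀ f, ⟪ψ, coherent f⟫ = 0) : ψ = 0 := by
  refine eq_zero_of_inner_tensorPow fun n f => ?_
  -- The power series in `z` of `⟪ψ, coherent (z • f)⟫`. It represents the zero function, so each
  -- coefficient vanishes, and the coefficients isolate the sectors.
  let p : FormalMultilinearSeries ℂ ℂ ℂ :=
    FormalMultilinearSeries.ofScalars ℂ fun n => coeffFact n * ⟪ψ.1 n, tensorPow f n⟫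
  have hp : HasFPowerSeriesAt (fun _ : ℂ => (0 : ℂ)) p 0 := by
    rw [hasFPowerSeriesAt_iff]
    refine Eventually.of_forall fun z => ?_
    have := inner_coherent_left_hasSum f ψ z
    rw [h] at this
    simpa [p, FormalMultilinearSeries.coeff_ofScalars] using this
  have := congrArg (fun q => q.coeff n) hp.eq_zero
  rw [FormalMultilinearSeries.coeff_ofScalars] at this
  exact (mul_eq_zero.1 this).resolve_left (coeffFact_ne_zero n)

lemma ext_inner_coherent {ψ χ : Fock} (h : ∀ f, ⟪coherent f, ψ⟫ = ⟪coherent f, χ⟫) : ψ = χ := by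
  refine sub_eq_zero.1 (eq_zero_of_inner_coherent fun f => ?_)
  rw [← inner_conj_symm, inner_sub_right, h, sub_self, map_zero]

lemma dense_span_coherent : Dense (Submodule.span ℂ (Set.range coherent) : Set Fock) := by
  rw [Submodule.dense_iff_topologicalClosure_eq_top, Submodule.topologicalClosure_eq_top_iff,
    Submodule.eq_bot_iff]
  intro ψ hψ
  exact eq_zero_of_inner_coherent fun f =>
    Submodule.inner_left_of_mem_orthogonal (Submodule.subset_span (Set.mem_range_self f)) hψ

lemma vacuum_eq_coherent : vacuum = coherent 0 := by
  refine Subtype.ext (lp.ext (funext fun n => ?_))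
  rw [coherent_apply]
  cases n with
  | zero => 
    rw [vacuum, lp.single_apply_self]
    simp [coeffFact]
  | succ n =>
    rw [vacuum, lp.single_apply_ne _ _ _ (Nat.succ_ne_zero n)]
    have : tensorPow 0 (n + 1) = 0 := by rw [← norm_eq_zero, norm_tensorPow]; simp
    rw [this, smul_zero]

/-! ### Field operators on coherent vectors -/

/-- Fubini for null sets. `annihilate` integrates a representative of an `L²` class over
one-dimensional slices, so changing the representative needs this. -/
lemma ae_ae_cons {n : ℕ} {p : (Fin (n + 1) → ℝ) → Prop} (h : ∀ᵐ k, p k) :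
    ∀ᵐ k : Fin n → ℝ, ∀ᵐ q : ℝ, p (Fin.cons q k) := by
  have mp := (volume_preserving_piFinSuccAbove (fun _ : Fin (n + 1) => ℝ) 0).symm
  have h1 := (mp.comp (Measure.measurePreserving_swap
    (μ := (volume : Measure (Fin n → ℝ))) (ν := (volume : Measure ℝ)))).quasiMeasurePreserving.ae h
  simpa using! Measure.ae_ae_of_ae_prod h1

lemma ae_succAbove {n : ℕ} (j : Fin (n + 1)) {p : (Fin n → ℝ) → Prop} (h : ∀ᵐ k, p k) :
    ∀ᵐ k : Fin (n + 1) → ℝ, p fun i => k (j.succAbove i) := by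
  have mp := volume_preserving_piFinSuccAbove (fun _ : Fin (n + 1) => ℝ) j
  exact (Measure.quasiMeasurePreserving_snd.comp mp.quasiMeasurePreserving).ae h

lemma annihilate_congr (h : OneParticle) {ψ : Fock} {n : ℕ} {u : (Fin (n + 1) → ℝ) → ℂ}
    (hu : wave ψ (n + 1) =ᵐ[volume] u) : ∀ᵐ k : Fin n → ℝ, annihilate h ψ n k =
      (Real.sqrt (n + 1) : ℂ) * ∫ p : ℝ, (starRingEnd ℂ) (h p) * u (Fin.cons p k) := by
  filter_upwards [ae_ae_cons hu] with k hk
  rw [annihilate]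
  congr 1
  refine integral_congr_ae ?_
  filter_upwards [hk] with p hp
  rw [hp]

lemma wave_smul (c : ℂ) (ψ : Fock) (n : ℕ) :
    wave (c • ψ) n =ᵐ[volume] fun k => c * wave ψ n k :=
  Lp.coeFn_smul c (ψ.1 n)

lemma wave_add (ψ χ : Fock) (n : ℕ) :
    wave (ψ + χ) n =ᵐ[volume] fun k => wave ψ n k + wave χ n k :=
  Lp.coeFn_add (ψ.1 n) (χ.1 n)

lemma IsField.smul {h : OneParticle} {ψ χ : Fock} (c : ℂ) (H : IsField h ψ χ) :
    IsField h (c • ψ) (c • χ) := by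
  intro n
  have hc : ∀ᵐ k : Fin n → ℝ, create h (c • ψ) n k = c * create h ψ n k := by
    cases n with
    | zero => simp [create]
    | succ n =>
      have : ∀ j : Fin (n + 1), ∀ᵐ k : Fin (n + 1) → ℝ,
          wave (c • ψ) n (fun i => k (j.succAbove i)) = c * wave ψ n fun i => k (j.succAbove i) :=
        fun j => ae_succAbove j (wave_smul c ψ n)
      filter_upwards [ae_all_iff.2 this] with k hk
      simp only [create, hk, Finset.mul_sum]
      exact Finset.sum_congr rfl fun j _ => by ring
  filter_upwards [H n, wave_smul c χ n, annihilate_congr h (wave_smul c ψ (n + 1)), hc]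
    with k h1 h2 h3 h4
  rw [h2, h1, h3, h4, mul_add, annihilate, ← mul_assoc c, mul_comm c, mul_assoc,
    ← integral_const_mul]
  congr 3
  ext p
  ring

lemma sqrt_mul_coeffFact_succ (n : ℕ) :
    (Real.sqrt (n + 1) : ℂ) * coeffFact (n + 1) = coeffFact n := by
  rw [coeffFact, coeffFact, ← Complex.ofReal_mul, Nat.factorial_succ, Nat.cast_mul,
    Real.sqrt_mul (by positivity)]
  have : (0 : ℝ) < Real.sqrt ((n : ℝ) + 1) := Real.sqrt_pos.2 (by positivity)
  push_cast
  have h2 : (Real.sqrt ((n : ℝ) + 1) : ℂ) ≠ 0 := by exact_mod_cast this.ne'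
  field_simp

lemma sqrt_succ_ne_zero (n : ℕ) : (Real.sqrt (n + 1) : ℂ) ≠ 0 := by
  have : (0 : ℝ) < Real.sqrt ((n : ℝ) + 1) := Real.sqrt_pos.2 (by positivity)
  exact_mod_cast this.ne'

lemma sqrt_succ_mul_self (n : ℕ) : (Real.sqrt (n + 1) : ℂ) * Real.sqrt (n + 1) = n + 1 := by
  rw [← Complex.ofReal_mul, Real.mul_self_sqrt (by positivity)]
  push_cast
  rfl

lemma wave_coherent (f : OneParticle) (n : ℕ) :
    wave (coherent f) n =ᵐ[volume] fun k => coeffFact n * ∏ j, f (k j) := by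
  have h1 : wave (coherent f) n =ᵐ[volume] fun k => coeffFact n * tensorPow f n k := by
    rw [wave, coherent_apply]
    exact Lp.coeFn_smul _ _
  filter_upwards [h1, coeFn_tensor fun _ : Fin n => f] with k hk hk'
  rw [hk, tensorPow_eq_tensor, hk']

lemma tensor_update_const_ae {n : ℕ} (h f : OneParticle) (j : Fin (n + 1)) :
    tensor (Function.update (fun _ => f) j h) =ᵐ[volume]
      fun k => h (k j) * ∏ i, f (k (j.succAbove i)) := by
  filter_upwards [coeFn_tensor (Function.update (fun _ => f) j h)] with k hk
  rw [hk, Fin.prod_univ_succAbove _ j]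
  simp

lemma wave_creation_succ (h f : OneParticle) (n : ℕ) :
    wave (creation h f) (n + 1) =ᵐ[volume] fun k => coeffFact (n + 1) *
      ∑ j, h (k j) * ∏ i, f (k (j.succAbove i)) := by
  have h1 : wave (creation h f) (n + 1) =ᵐ[volume]
      fun k => coeffFact (n + 1) * tensorInsert h f (n + 1) k := by
    rw [wave, creation_apply]
    exact Lp.coeFn_smul _ _
  have h2 : tensorInsert h f (n + 1) =ᵐ[volume]
      fun k => ∑ j, tensor (Function.update (fun _ : Fin (n + 1) => f) j h) k := by
    rw [tensorInsert]
    exact Lp.coeFn_fun_finsetSum _ _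
  filter_upwards [h1, h2, ae_all_iff.2 fun j : Fin (n + 1) => tensor_update_const_ae h f j]
    with k hk hk' hk''
  rw [hk, hk']
  congr 1
  exact Finset.sum_congr rfl fun j _ => hk'' j

/-- The image of the coherent vector of `f` under the field operator `Φ(h)`. -/
def fieldCoherent (h f : OneParticle) : Fock := ⟪h, f⟫ • coherent f + creation h f

/-- Coherent vectors are eigenvectors of annihilation with eigenvalue `⟪h, f⟫`, while creation
inserts `h` in each slot. The weights `1/√n!` match the factors `√(n+1)` in both cases. -/
lemma isField_coherent (h f : OneParticle) : IsField h (coherent f) (fieldCoherent h f) := by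
  intro n
  have ha : ∀ᵐ k : Fin n → ℝ,
      annihilate h (coherent f) n k = ⟪h, f⟫ * (coeffFact n * ∏ j, f (k j)) := by
    filter_upwards [annihilate_congr h (wave_coherent f (n + 1))] with k hk
    rw [hk]
    simp only [Fin.prod_univ_succ, Fin.cons_zero, Fin.cons_succ]
    have : ∀ p : ℝ, (starRingEnd ℂ) (h p) * (coeffFact (n + 1) * (f p * ∏ i, f (k i))) =
        (coeffFact (n + 1) * ∏ i, f (k i)) * ⟪h p, f p⟫ := by
      intro p
      rw [RCLike.inner_apply]
      ring
    simp_rw [this]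
    rw [integral_const_mul, ← L2.inner_def, ← sqrt_mul_coeffFact_succ n]
    ring
  have hc : ∀ᵐ k : Fin n → ℝ, create h (coherent f) n k = wave (creation h f) n k := by
    cases n with
    | zero =>
      have : wave (creation h f) 0 =ᵐ[volume] 0 := by
        rw [wave, creation_apply]
        simp only [tensorInsert, Finset.univ_eq_empty, Finset.sum_empty, smul_zero]
        exact Lp.coeFn_zero _ _ _
      filter_upwards [this] with k hk
      simp [create, hk]
    | succ n =>
      filter_upwards [wave_creation_succ h f n, ae_all_iff.2 fun j : Fin (n + 1) =>
        ae_succAbove j (wave_coherent f n)] with k hk hk'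
      rw [hk]
      simp only [create, hk']
      rw [← sqrt_mul_coeffFact_succ n, Finset.mul_sum, Finset.mul_sum]
      refine Finset.sum_congr rfl fun j _ => ?_
      field_simp [sqrt_succ_ne_zero n]
  filter_upwards [ha, hc, wave_add (⟪h, f⟫ • coherent f) (creation h f) n,
    wave_smul ⟪h, f⟫ (coherent f) n, wave_coherent f n] with k h1 h2 h3 h4 h5
  rw [fieldCoherent, h3, h4, h5, h1, h2]

/-- Permutation symmetry of `ψ` in the only form needed. The difference of the two tensors is
orthogonal to all tensor powers, hence to their closed span. -/
lemma inner_tensor_update_eq (h f : OneParticle) (ψ : Fock) {n : ℕ} (i j : Fin n) :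
    ⟪tensor (Function.update (fun _ => f) i h), ψ.1 n⟫ =
      ⟪tensor (Function.update (fun _ => f) j h), ψ.1 n⟫ := by
  have hu : ∀ (j : Fin n) (u : OneParticle),
      ⟪tensor (Function.update (fun _ => f) j h), tensorPow u n⟫ = ⟪h, u⟫ * ⟪f, u⟫ ^ (n - 1) := by
    intro j u
    rw [tensorPow_eq_tensor, inner_tensor, ← Finset.mul_prod_erase _ _ (Finset.mem_univ j),
      Finset.prod_congr rfl (g := fun _ => ⟪f, u⟫) fun i hi => by
        rw [Function.update_of_ne (Finset.ne_of_mem_erase hi)]]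
    simp
  have h1 : bosonFock ≤ (ℂ ∙ (lp.single 2 n (tensor (Function.update (fun _ => f) i h) -
      tensor (Function.update (fun _ => f) j h)) : FullFock))ᗮ := by
    refine Submodule.topologicalClosure_minimal _ (Submodule.span_le.2 ?_)
      (Submodule.isClosed_orthogonal _)
    rintro _ ⟨l, u, rfl⟩
    rw [SetLike.mem_coe, Submodule.mem_orthogonal_singleton_iff_inner_right,
      lp.inner_single_left]
    rcases eq_or_ne l n with rfl | hl
    · rw [lp.single_apply_self, inner_sub_left, hu, hu, sub_self]
    · rw [lp.single_apply_ne _ _ _ hl.symm, inner_zero_right]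
  have h2 := Submodule.mem_orthogonal_singleton_iff_inner_right.1 (h1 ψ.2)
  rw [lp.inner_single_left, inner_sub_left] at h2
  exact sub_eq_zero.1 h2

lemma inner_tensorPow_eq_integral (f : OneParticle) {n : ℕ} (v : Sector n) :
    ⟪tensorPow f n, v⟫ = ∫ k, (starRingEnd ℂ) (∏ j, f (k j)) * v k := by
  rw [L2.inner_def]
  refine integral_congr_ae ?_
  filter_upwards [coeFn_tensor fun _ : Fin n => f] with k hk
  rw [RCLike.inner_apply, mul_comm, tensorPow_eq_tensor, hk]

/-- Fubini moves the annihilation operator to the other side as an insertion of `h`. Integrability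
is recorded so that the sum in `IsField` can be integrated term by term. -/
lemma annihilate_pairing (h f : OneParticle) (ψ : Fock) (n : ℕ) :
    Integrable (fun k => (starRingEnd ℂ) (∏ j, f (k j)) * annihilate h ψ n k) ∧
    ∫ k, (starRingEnd ℂ) (∏ j, f (k j)) * annihilate h ψ n k =
      (Real.sqrt (n + 1) : ℂ) *
        ⟪tensor (Function.update (fun _ : Fin (n + 1) => f) 0 h), ψ.1 (n + 1)⟫ := by
  have mp := (volume_preserving_piFinSuccAbove (fun _ : Fin (n + 1) => ℝ) 0).symm
  set T := tensor (Function.update (fun _ : Fin (n + 1) => f) 0 h)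
  let G : (Fin (n + 1) → ℝ) → ℂ := fun K =>
    (starRingEnd ℂ) (h (K 0) * ∏ i : Fin n, f (K i.succ)) * wave ψ (n + 1) K
  have hG : (fun K => ⟪T K, (ψ.1 (n + 1) : Sector (n + 1)) K⟫) =ᵐ[volume] G := by
    filter_upwards [tensor_update_const_ae h f (0 : Fin (n + 1))] with K hK
    rw [RCLike.inner_apply, mul_comm, hK]
    simp only [G, Fin.zero_succAbove]
    rfl
  have hGi : Integrable G := (L2.integrable_inner T (ψ.1 (n + 1))).congr hG
  have hGp : Integrable (fun x => G ((MeasurableEquiv.piFinSuccAbove (fun _ : Fin (n + 1) => ℝ)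
      0).symm x)) (volume.prod volume) :=
    (mp.integrable_comp_emb (MeasurableEquiv.measurableEmbedding _)).2 hGi
  have hGe : ∀ (q : ℝ) (k : Fin n → ℝ),
      G ((MeasurableEquiv.piFinSuccAbove (fun _ : Fin (n + 1) => ℝ) 0).symm (q, k)) =
        (starRingEnd ℂ) (∏ j, f (k j)) * ((starRingEnd ℂ) (h q) * wave ψ (n + 1) (Fin.cons q k)) := by
    intro q k
    have : (MeasurableEquiv.piFinSuccAbove (fun _ : Fin (n + 1) => ℝ) 0).symm (q, k) =
        Fin.cons q k := Fin.insertNth_zero' _ _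
    rw [this]
    simp only [G, Fin.cons_zero, Fin.cons_succ, map_mul]
    ring
  have h1 : ∀ k : Fin n → ℝ, (starRingEnd ℂ) (∏ j, f (k j)) * annihilate h ψ n k =
      (Real.sqrt (n + 1) : ℂ) * ∫ q, G ((MeasurableEquiv.piFinSuccAbove
        (fun _ : Fin (n + 1) => ℝ) 0).symm (q, k)) := by
    intro k
    simp_rw [hGe]
    rw [integral_const_mul, annihilate]
    ring
  simp_rw [h1]
  refine ⟨hGp.integral_prod_right.const_mul _, ?_⟩
  rw [integral_const_mul, L2.inner_def, integral_congr_ae hG, ← mp.integral_comp' (g := G)]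
  congr 1
  exact (integral_prod_symm _ hGp).symm

lemma create_pairing (h f : OneParticle) (ψ : Fock) (n : ℕ) :
    Integrable (fun k => (starRingEnd ℂ) (∏ j, f (k j)) * create h ψ (n + 1) k) ∧
    ∫ k, (starRingEnd ℂ) (∏ j, f (k j)) * create h ψ (n + 1) k =
      (Real.sqrt (n + 1) : ℂ) * (⟪f, h⟫ * ⟪tensorPow f n, ψ.1 n⟫) := by
  have key : ∀ j : Fin (n + 1),
      Integrable (fun k : Fin (n + 1) → ℝ => (starRingEnd ℂ) (∏ j, f (k j)) *
        (h (k j) * wave ψ n fun i => k (j.succAbove i))) ∧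
      ∫ k : Fin (n + 1) → ℝ, (starRingEnd ℂ) (∏ j, f (k j)) *
        (h (k j) * wave ψ n fun i => k (j.succAbove i)) = ⟪f, h⟫ * ⟪tensorPow f n, ψ.1 n⟫ := by
    intro j
    have mp := volume_preserving_piFinSuccAbove (fun _ : Fin (n + 1) => ℝ) j
    let u : ℝ → ℂ := fun q => ⟪f q, h q⟫
    let v : (Fin n → ℝ) → ℂ := fun k => (starRingEnd ℂ) (∏ j, f (k j)) * wave ψ n k
    have hu : Integrable u := L2.integrable_inner f h
    have hv : Integrable v := by
      refine (L2.integrable_inner (tensorPow f n) (ψ.1 n)).congr ?_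
      filter_upwards [coeFn_tensor fun _ : Fin n => f] with k hk
      rw [RCLike.inner_apply, mul_comm, tensorPow_eq_tensor, hk]
      rfl
    have he : ∀ k : Fin (n + 1) → ℝ, (starRingEnd ℂ) (∏ j, f (k j)) *
        (h (k j) * wave ψ n fun i => k (j.succAbove i)) =
        (fun x : ℝ × (Fin n → ℝ) => u x.1 * v x.2)
          (MeasurableEquiv.piFinSuccAbove (fun _ : Fin (n + 1) => ℝ) j k) := by
      intro k
      have : MeasurableEquiv.piFinSuccAbove (fun _ : Fin (n + 1) => ℝ) j k =
        (k j, fun i => k (j.succAbove i)) := rfl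
      rw [this, Fin.prod_univ_succAbove _ j]
      simp only [u, v, RCLike.inner_apply, map_mul]
      ring
    simp_rw [he]
    refine ⟨(mp.integrable_comp_emb (MeasurableEquiv.measurableEmbedding _)).2 (hu.mul_prod hv), ?_⟩
    rw [mp.integral_comp' (g := fun x : ℝ × (Fin n → ℝ) => u x.1 * v x.2)]
    refine (integral_prod_mul u v).trans ?_
    rw [inner_tensorPow_eq_integral]
    rfl
  have h1 : ∀ k : Fin (n + 1) → ℝ, (starRingEnd ℂ) (∏ j, f (k j)) * create h ψ (n + 1) k =
      (Real.sqrt (n + 1) : ℂ)⁻¹ * ∑ j : Fin (n + 1), (starRingEnd ℂ) (∏ j, f (k j)) *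
        (h (k j) * wave ψ n fun i => k (j.succAbove i)) := by
    intro k
    rw [create, ← Finset.mul_sum]
    ring
  simp_rw [h1]
  refine ⟨(integrable_finsetSum _ fun j _ => (key j).1).const_mul _, ?_⟩
  rw [integral_const_mul, integral_finsetSum _ fun j _ => (key j).1,
    Finset.sum_congr rfl fun j _ => (key j).2, Finset.sum_const, Finset.card_univ, Fintype.card_fin,
    nsmul_eq_mul, Nat.cast_succ, ← sqrt_succ_mul_self]
  have := sqrt_succ_ne_zero n
  field_simp

lemma inner_creation_succ (h f : OneParticle) (ψ : Fock) (n : ℕ) :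
    ⟪(creation h f).1 (n + 1), ψ.1 (n + 1)⟫ = coeffFact n * ((Real.sqrt (n + 1) : ℂ) *
        ⟪tensor (Function.update (fun _ : Fin (n + 1) => f) 0 h), ψ.1 (n + 1)⟫) := by
  rw [creation_apply, tensorInsert, inner_smul_left, conj_coeffFact, sum_inner,
    Finset.sum_congr rfl fun j _ => inner_tensor_update_eq h f ψ j 0, Finset.sum_const,
    Finset.card_univ, Fintype.card_fin, nsmul_eq_mul, Nat.cast_succ, ← sqrt_succ_mul_self,
    ← sqrt_mul_coeffFact_succ n]
  ring

/-- On coherent vectors the maximal field operator is symmetric. -/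
lemma IsField.inner_coherent {h : OneParticle} {ψ χ : Fock} (H : IsField h ψ χ) (f : OneParticle) :
    ⟪fieldCoherent h f, ψ⟫ = ⟪coherent f, χ⟫ := by
  let a : ℕ → ℂ := fun n => ⟪(creation h f).1 n, ψ.1 n⟫
  let b : ℕ → ℂ := fun n => ⟪f, h⟫ * ⟪(coherent f).1 n, ψ.1 n⟫
  -- Creation raises the particle number by one, so its contribution is shifted by one sector and is
  -- zero in the vacuum sector.
  let b' : ℕ → ℂ := fun n => n.casesOn 0 b
  have ha0 : a 0 = 0 := by
    simp [a, creation_apply, tensorInsert]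
  have ha : HasSum (fun n => a (n + 1)) ⟪creation h f, ψ⟫ := by
    have := (hasSum_nat_add_iff' 1).2 (hasSum_inner_fock (creation h f) ψ)
    simpa [ha0, a] using this
  have hb : HasSum b' (⟪f, h⟫ * ⟪coherent f, ψ⟫) := by
    have h0 := (hasSum_inner_fock (coherent f) ψ).mul_left ⟪f, h⟫
    have := (hasSum_nat_add_iff (f := b') 1).1 h0
    simpa [b'] using this
  have hint : ∀ n, ∫ k, (starRingEnd ℂ) (∏ j, f (k j)) * (χ.1 n : Sector n) k =
      ∫ k, ((starRingEnd ℂ) (∏ j, f (k j)) * annihilate h ψ n k +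
        (starRingEnd ℂ) (∏ j, f (k j)) * create h ψ n k) := fun n => by
    refine integral_congr_ae ?_
    filter_upwards [H n] with k hk
    rw [← mul_add, ← hk]
    rfl
  have hc : ∀ n, ⟪(coherent f).1 n, χ.1 n⟫ = a (n + 1) + b' n := by
    intro n
    rw [coherent_apply, inner_smul_left, conj_coeffFact, inner_tensorPow_eq_integral, hint]
    simp only [a]
    rw [inner_creation_succ, ← (annihilate_pairing h f ψ n).2]
    cases n with
    | zero => simp [create, b']
    | succ n =>
      rw [integral_add (annihilate_pairing h f ψ (n + 1)).1 (create_pairing h f ψ n).1, mul_add,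
        (create_pairing h f ψ n).2]
      congr 1
      simp only [b', b]
      rw [coherent_apply, inner_smul_left, conj_coeffFact, ← sqrt_mul_coeffFact_succ n]
      ring
  have hs := hasSum_inner_fock (coherent f) χ
  simp_rw [hc] at hs
  rw [hs.unique (ha.add hb), fieldCoherent, inner_add_left, inner_smul_left, inner_conj_symm,
    add_comm]

/-! ### Weyl operators -/

/-- Equal Gram matrices give equal norms of formal linear combinations. The map between their images
is thus well defined even if the families are linearly dependent, and it extends by density. -/
lemma exists_isometry_of_inner_eq {ι H : Type*} [NormedAddCommGroup H] [InnerProductSpace ℂ H]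
    [CompleteSpace H] {v w : ι → H} (hv : Dense (Submodule.span ℂ (Set.range v) : Set H))
    (h : ∀ i j, ⟪v i, v j⟫ = ⟪w i, w j⟫) :
    ∃ T : H →L[ℂ] H, (∀ i, T (v i) = w i) ∧ ∀ x, ‖T x‖ = ‖x‖ := by
  let V := Finsupp.linearCombination ℂ v
  let W := Finsupp.linearCombination ℂ w
  have hinner : ∀ x, ⟪V x, V x⟫ = ⟪W x, W x⟫ := by
    intro x
    simp only [V, W, Finsupp.linearCombination_apply, Finsupp.sum, sum_inner, inner_sum,
      inner_smul_left, inner_smul_right, h]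
  have hnorm : ∀ x, ‖W x‖ = ‖V x‖ := by
    intro x
    have := hinner x
    simp only [inner_self_eq_norm_sq_to_K] at this
    exact ((sq_eq_sq₀ (norm_nonneg _) (norm_nonneg _)).1 (by exact_mod_cast this)).symm
  have hd : DenseRange V := by
    have : Set.range V = (Submodule.span ℂ (Set.range v) : Set H) := by
      rw [← Finsupp.range_linearCombination, LinearMap.coe_range]
    rw [DenseRange, this]
    exact hv
  have hb : ∃ C, ∀ x, ‖W x‖ ≤ C * ‖V x‖ := ⟨1, fun x => by rw [hnorm, one_mul]⟩
  have hT := LinearMap.extendOfNorm_eq (f := W) (e := V) hd hb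
  refine ⟨W.extendOfNorm V, fun i => ?_, fun x => ?_⟩
  · simpa [V, W] using hT (Finsupp.single i 1)
  · refine hd.induction_on (p := fun x => ‖W.extendOfNorm V x‖ = ‖x‖) x
      (isClosed_eq (by fun_prop) (by fun_prop)) fun y => ?_
    rw [hT, hnorm]

lemma clm_ext_coherent {A B : Fock →L[ℂ] Fock} (h : ∀ f, A (coherent f) = B (coherent f)) :
    A = B :=
  ContinuousLinearMap.ext_on dense_span_coherent (by rintro _ ⟨f, rfl⟩; exact h f)

/-- The scalar with `W(h) coherent f = weylCoeff h f • coherent (f + h)`. -/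
def weylCoeff (h f : OneParticle) : ℂ := Complex.exp (-⟪h, h⟫ / 2 - ⟪h, f⟫)

/-- The prefactor `weylCoeff` exactly compensates the change of the kernel `exp ⟪f, g⟫` when both
arguments are translated by `h`. -/
lemma exists_weyl (h : OneParticle) : ∃ T : Fock →L[ℂ] Fock,
    (∀ f, T (coherent f) = weylCoeff h f • coherent (f + h)) ∧ ∀ x, ‖T x‖ = ‖x‖ := by
  refine exists_isometry_of_inner_eq dense_span_coherent fun f g => ?_
  rw [inner_smul_left, inner_smul_right, inner_coherent, inner_coherent, weylCoeff, weylCoeff,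
    ← Complex.exp_conj, ← Complex.exp_add, ← Complex.exp_add]
  congr 1
  simp only [map_sub, map_neg, map_div₀, inner_conj_symm, inner_add_left, inner_add_right,
    Complex.conj_ofNat]
  ring

/-- The Weyl operator `W(h) = exp(a*(h) - a(h))`. -/
def weyl (h : OneParticle) : Fock →L[ℂ] Fock := (exists_weyl h).choose

lemma weyl_coherent (h f : OneParticle) :
    weyl h (coherent f) = weylCoeff h f • coherent (f + h) := (exists_weyl h).choose_spec.1 f

lemma norm_weyl_apply (h : OneParticle) (ψ : Fock) : ‖weyl h ψ‖ = ‖ψ‖ :=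
  (exists_weyl h).choose_spec.2 ψ

lemma weyl_mul (u v : OneParticle) :
    weyl u * weyl v = Complex.exp ((⟪v, u⟫ - ⟪u, v⟫) / 2) • weyl (u + v) := by
  refine clm_ext_coherent fun f => ?_
  rw [mul_apply_eq_comp, weyl_coherent, map_smul, weyl_coherent,
    smul_apply, weyl_coherent, smul_smul, smul_smul, add_assoc, add_comm v u]
  congr 1
  simp only [weylCoeff, ← Complex.exp_add, inner_add_left, inner_add_right]
  congr 1
  ring

lemma weyl_zero : weyl 0 = 1 := clm_ext_coherent fun f => by
  simp [weyl_coherent, weylCoeff]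

lemma weyl_mul_neg (h : OneParticle) : weyl h * weyl (-h) = 1 := by
  rw [weyl_mul]
  simp [weyl_zero]

lemma star_weyl_mul_self (h : OneParticle) : star (weyl h) * weyl h = 1 :=
  (ContinuousLinearMap.norm_map_iff_adjoint_comp_self _).1 (norm_weyl_apply h)

lemma star_weyl (h : OneParticle) : star (weyl h) = weyl (-h) := by
  calc star (weyl h) = star (weyl h) * (weyl h * weyl (-h)) := by rw [weyl_mul_neg, mul_one]
    _ = weyl (-h) := by rw [← mul_assoc, star_weyl_mul_self, one_mul]

lemma weyl_mem_unitary (h : OneParticle) : weyl h ∈ unitary (Fock →L[ℂ] Fock) :=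
  ⟨star_weyl_mul_self h, by rw [star_weyl, weyl_mul_neg]⟩

lemma inner_weyl_right (h : OneParticle) (ψ χ : Fock) : ⟪ψ, weyl h χ⟫ = ⟪weyl (-h) ψ, χ⟫ := by
  rw [← star_weyl, ContinuousLinearMap.star_eq_adjoint, ContinuousLinearMap.adjoint_inner_left]

/-- The one-parameter group `t ↦ W(i t h) = exp(i t Φ(h))`. -/
def weylGroup (h : OneParticle) (t : ℝ) : Fock →L[ℂ] Fock := weyl ((Complex.I * t) • h)

lemma weylGroup_add (h : OneParticle) (s t : ℝ) :
    weylGroup h (s + t) = weylGroup h s * weylGroup h t := by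
  rw [weylGroup, weylGroup, weylGroup, weyl_mul]
  simp only [inner_smul_left, inner_smul_right, map_mul, Complex.conj_I, Complex.conj_ofReal]
  rw [← add_smul, show ((Complex.I * s * (-Complex.I * t * ⟪h, h⟫) -
    Complex.I * t * (-Complex.I * s * ⟪h, h⟫)) / 2) = 0 by ring, Complex.exp_zero, one_smul]
  push_cast
  rw [mul_add]

lemma weylGroup_neg (h : OneParticle) (t : ℝ) :
    weylGroup h (-t) = weyl (-((Complex.I * t) • h)) := by
  rw [weylGroup, ← neg_smul]
  push_cast
  rw [mul_neg]

lemma weylGroup_zero (h : OneParticle) : weylGroup h 0 = 1 := by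
  simp [weylGroup, weyl_zero]

/-! ### Strong continuity and the generator of the Weyl group -/

lemma hasDerivAt_weylGroup_coherent_zero (h f : OneParticle) :
    HasDerivAt (fun t => weylGroup h t (coherent f)) (Complex.I • fieldCoherent h f) 0 := by
  have h1 : HasDerivAt (fun t : ℝ => Complex.I * (t : ℂ)) Complex.I 0 := by
    simpa using (Complex.ofRealCLM.hasDerivAt (x := (0 : ℝ))).const_mul Complex.I
  have h2 : HasDerivAt (fun t : ℝ => coherent (f + (Complex.I * (t : ℂ)) • h))
      (Complex.I • creation h f) 0 := by
    have := hasDerivAt_coherent h f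
    exact HasDerivAt.scomp (0 : ℝ) (by simpa using this) h1
  have h3 : HasDerivAt (fun t : ℝ => weylCoeff ((Complex.I * (t : ℂ)) • h) f)
      (Complex.I * ⟪h, f⟫) 0 := by
    have : ∀ t : ℝ, weylCoeff ((Complex.I * (t : ℂ)) • h) f =
        Complex.exp ((Complex.I * t) * (Complex.I * t) * ⟪h, h⟫ / 2 + Complex.I * t * ⟪h, f⟫) := by
      intro t
      rw [weylCoeff]
      congr 1
      simp only [inner_smul_left, inner_smul_right, map_mul, Complex.conj_I, Complex.conj_ofReal]
      ring
    simp_rw [this]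
    have := ((((h1.mul h1).mul_const ⟪h, h⟫).div_const 2).add (h1.mul_const ⟪h, f⟫)).cexp
    simpa using this
  have h4 := h3.smul h2
  simp only [weylGroup, weyl_coherent]
  refine h4.congr_deriv ?_
  simp [fieldCoherent, weylCoeff, smul_smul, add_comm]

lemma hasDerivAt_weylGroup_coherent (h f : OneParticle) (t : ℝ) :
    HasDerivAt (fun t => weylGroup h t (coherent f)) ((Complex.I * weylCoeff ((Complex.I * t) • h) f) •
      fieldCoherent h (f + (Complex.I * t) • h)) t := by
  have h1 := (hasDerivAt_weylGroup_coherent_zero h (f + (Complex.I * t) • h)).const_smul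
    (weylCoeff ((Complex.I * t) • h) f)
  rw [smul_smul, mul_comm _ Complex.I] at h1
  have h2 : HasDerivAt (fun s : ℝ => s - t) 1 t := (hasDerivAt_id t).sub_const t
  have h3 := HasDerivAt.scomp t (by simpa using h1) h2
  rw [one_smul] at h3
  refine h3.congr_of_eventuallyEq (Eventually.of_forall fun s => ?_)
  have : weylGroup h s = weylGroup h (s - t) * weylGroup h t := by
    rw [← weylGroup_add, sub_add_cancel]
  change weylGroup h s (coherent f) = _
  rw [this, mul_apply_eq_comp, show weylGroup h t = weyl ((Complex.I * t) • h) from rfl,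
    weyl_coherent, map_smul]
  rfl

lemma continuous_weylGroup_apply (h : OneParticle) (ψ : Fock) :
    Continuous fun t => weylGroup h t ψ := by
  refine dense_span_coherent.induction (P := fun ψ => Continuous fun t => weylGroup h t ψ)
    (fun x hx => ?_) ?_ ψ
  · induction hx using Submodule.span_induction with
    | mem x hx =>
      obtain ⟨f, rfl⟩ := hx
      exact continuous_iff_continuousAt.2 fun t =>
        (hasDerivAt_weylGroup_coherent h f t).continuousAt
    | zero => simpa using continuous_const
    | add x y _ _ hx hy =>
      simp only [map_add]
      exact hx.add hy
    | smul c x _ hx =>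
      simp only [map_smul]
      exact hx.const_smul c
  -- Isometry makes the approximation uniform in `t`, so continuity of orbits passes to norm limits
  -- of vectors.
  · refine isClosed_of_closure_subset fun ψ hψ => ?_
    rw [Metric.mem_closure_iff] at hψ
    refine Metric.continuous_iff'.2 fun t ε hε => ?_
    obtain ⟨χ, hχ, hd⟩ := hψ (ε / 3) (by positivity)
    filter_upwards [Metric.continuous_iff'.1 hχ t (ε / 3) (by positivity)] with s hs
    have h1 : ∀ t, dist (weylGroup h t ψ) (weylGroup h t χ) = dist ψ χ := fun t => by
      rw [dist_eq_norm, ← map_sub, weylGroup, norm_weyl_apply, dist_eq_norm]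
    calc dist (weylGroup h s ψ) (weylGroup h t ψ)
        ≤ dist (weylGroup h s ψ) (weylGroup h s χ) + dist (weylGroup h s χ) (weylGroup h t χ)
          + dist (weylGroup h t χ) (weylGroup h t ψ) := dist_triangle4 _ _ _ _
      _ < ε := by
        rw [dist_comm (weylGroup h t χ), h1, h1]
        linarith

/-- A vector of the maximal domain need not be approximated by coherent vectors in graph norm.
Instead the group is moved onto a coherent vector, where it is differentiable, and
`IsField.inner_coherent` brings the generator back to `ψ`. The weak derivative integrates to an
identity between vectors, which gives the strong derivative. -/
lemma IsField.hasDerivAt_weylGroup {h : OneParticle} {ψ χ : Fock} (H : IsField h ψ χ) :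
    HasDerivAt (fun t => weylGroup h t ψ) (Complex.I • χ) 0 := by
  have hcont := continuous_weylGroup_apply h (Complex.I • χ)
  -- The norm-differentiable candidate for `weylGroup h t ψ - ψ`.
  let J : ℝ → Fock := fun t => ∫ s in (0 : ℝ)..t, weylGroup h s (Complex.I • χ)
  have hJ : ∀ t, HasDerivAt J (weylGroup h t (Complex.I • χ)) t := fun t =>
    intervalIntegral.integral_hasDerivAt_right (hcont.intervalIntegrable _ _)
      (hcont.stronglyMeasurableAtFilter _ _) hcont.continuousAt
  have hinner : ∀ f t, ⟪coherent f, weylGroup h t ψ⟫ = ⟪weylGroup h (-t) (coherent f), ψ⟫ :=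
    fun f t => by rw [weylGroup_neg, weylGroup, inner_weyl_right]
  have hw : ∀ f t, HasDerivAt (fun t => ⟪coherent f, weylGroup h t ψ⟫)
      ⟪coherent f, weylGroup h t (Complex.I • χ)⟫ t := by
    intro f t
    simp_rw [hinner]
    have h1 := HasDerivAt.scomp t (hasDerivAt_weylGroup_coherent h f (-t)) (hasDerivAt_neg t)
    have h2 := h1.inner ℂ (hasDerivAt_const t ψ)
    refine h2.congr_deriv ?_
    have h3 : ⟪coherent f, weylGroup h t (Complex.I • χ)⟫ =
        ⟪weyl ((Complex.I * ((-t : ℝ) : ℂ)) • h) (coherent f), Complex.I • χ⟫ := by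
      rw [show weylGroup h t = weyl ((Complex.I * t) • h) from rfl, inner_weyl_right,
        ← weylGroup_neg]
      rfl
    rw [h3, weyl_coherent, inner_zero_right, zero_add, inner_smul_right, inner_smul_left, ← H.inner_coherent, neg_smul, one_smul,
      inner_neg_left, inner_smul_left, map_mul, Complex.conj_I]
    ring
  have heq : ∀ t, weylGroup h t ψ = ψ + J t := by
    intro t
    refine ext_inner_coherent fun f => ?_
    have hd : ∀ t, HasDerivAt (fun t => ⟪coherent f, weylGroup h t ψ⟫ - ⟪coherent f, J t⟫) 0 t := by
      intro t
      have := (hw f t).sub ((hasDerivAt_const t (coherent f)).inner ℂ (hJ t))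
      refine this.congr_deriv ?_
      rw [inner_zero_left, add_zero, sub_self]
    have := is_const_of_deriv_eq_zero (fun t => (hd t).differentiableAt) (fun t => (hd t).deriv) t 0
    simp only [J, weylGroup_zero, intervalIntegral.integral_same, inner_zero_right, sub_zero,
      one_apply_eq_self] at this
    rw [inner_add_right, ← this]
    ring
  have := (hJ 0).const_add ψ
  rw [weylGroup_zero, one_apply_eq_self] at this
  exact this.congr_of_eventuallyEq (Eventually.of_forall heq)

lemma isUnitaryGroupOf_weylGroup (h : OneParticle) : IsUnitaryGroupOf (IsField h) (weylGroup h) where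
  unitary_mem _ := weyl_mem_unitary _
  zero := weylGroup_zero h
  add := weylGroup_add h
  cont := continuous_weylGroup_apply h
  deriv_zero _ _ H := H.hasDerivAt_weylGroup

/-! ### Uniqueness of the unitary group generated by a field operator -/

lemma IsUnitaryGroupOf.norm_apply {A : Fock → Fock → Prop} {U : ℝ → Fock →L[ℂ] Fock}
    (hU : IsUnitaryGroupOf A U) (t : ℝ) (ψ : Fock) : ‖U t ψ‖ = ‖ψ‖ :=
  (ContinuousLinearMap.norm_map_iff_adjoint_comp_self _).2 (hU.unitary_mem t).1 ψ

/-- A product rule in which the two derivatives cancel. As `U` is only strongly continuous, the part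
where `x` varies is treated by difference quotients, using that each `U (-s)` is isometric. -/
lemma IsUnitaryGroupOf.hasDerivAt_comp {A : Fock → Fock → Prop} {U : ℝ → Fock →L[ℂ] Fock}
    (hU : IsUnitaryGroupOf A U) {x : ℝ → Fock} {χ : Fock} {t : ℝ} (hx : HasDerivAt x (Complex.I • χ) t)
    (hA : HasDerivAt (fun s => U s (x t)) (Complex.I • χ) 0) :
    HasDerivAt (fun s => U (-s) (x s)) 0 t := by
  have h1 : HasDerivAt (fun s => U (-s) (x t)) (-(U (-t) (Complex.I • χ))) t := by
    have h2 := HasDerivAt.scomp (𝕜' := ℝ) t (g₁ := fun s => U s (x t)) (h := fun s : ℝ => t - s)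
      (by simpa using hA) ((hasDerivAt_id t).const_sub t)
    have h3 := (U (-t)).restrictScalars ℝ |>.hasFDerivAt.comp_hasDerivAt t h2
    refine (h3.congr_deriv (by simp)).congr_of_eventuallyEq (Eventually.of_forall fun s => ?_)
    simp only [Function.comp, ContinuousLinearMap.coe_restrictScalars']
    rw [← mul_apply_eq_comp, ← hU.add]
    congr 2
    ring
  have h4 : HasDerivAt (fun s => U (-s) (x s - x t)) (U (-t) (Complex.I • χ)) t := by
    rw [hasDerivAt_iff_tendsto_slope]
    have hs := hasDerivAt_iff_tendsto_slope.1 hx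
    have hc : Tendsto (fun s => U (-s) (Complex.I • χ)) (𝓝[≠] t) (𝓝 (U (-t) (Complex.I • χ))) :=
      (((hU.cont (Complex.I • χ)).comp continuous_neg).tendsto t).mono_left nhdsWithin_le_nhds
    have hz : Tendsto (fun s => U (-s) (slope x t s - Complex.I • χ)) (𝓝[≠] t) (𝓝 0) := by
      rw [tendsto_zero_iff_norm_tendsto_zero]
      simp_rw [hU.norm_apply]
      rw [← tendsto_zero_iff_norm_tendsto_zero]
      simpa using hs.sub_const (Complex.I • χ)
    refine (by simpa using hz.add hc : Tendsto _ _ (𝓝 (U (-t) (Complex.I • χ)))).congr fun s => ?_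
    simp only [slope_def_module, sub_self, sub_zero, map_sub]
    rw [← Complex.coe_smul, ← Complex.coe_smul, map_smul, map_sub]
  refine ((h1.add h4).congr_deriv (by simp)).congr_of_eventuallyEq (Eventually.of_forall fun s => ?_)
  simp

/-- The Weyl orbit of a coherent vector stays among multiples of coherent vectors, hence in the
domain where the derivative of `U` is prescribed. So `U (-s) (weylGroup h s (coherent f))` is
constant. This pins down the group picked by choice in `expI`. -/
lemma IsUnitaryGroupOf.eq_weylGroup {h : OneParticle} {U : ℝ → Fock →L[ℂ] Fock}
    (hU : IsUnitaryGroupOf (IsField h) U) : U = weylGroup h := by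
  have hd : ∀ f t, HasDerivAt (fun s => U (-s) (weylGroup h s (coherent f))) 0 t := by
    intro f t
    have h1 := hasDerivAt_weylGroup_coherent h f t
    rw [mul_smul] at h1
    refine hU.hasDerivAt_comp h1 ?_
    refine hU.deriv_zero _ _ ?_
    rw [weylGroup, weyl_coherent]
    exact (isField_coherent h _).smul _
  funext t
  refine clm_ext_coherent fun f => ?_
  have h1 := is_const_of_deriv_eq_zero (fun t => (hd f t).differentiableAt)
    (fun t => (hd f t).deriv) t 0
  simp only [weylGroup_zero, neg_zero, hU.zero, one_apply_eq_self] at h1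
  rw [← h1, ← mul_apply_eq_comp, ← hU.add, add_neg_cancel, hU.zero,
    one_apply_eq_self, h1]

/-- The exponential of a field operator is a Weyl operator. -/
lemma expI_isField (h : OneParticle) (t : ℝ) :
    expI (IsField h) t = weyl ((Complex.I * t) • h) := by
  have hex : ∃ U : ℝ → Fock →L[ℂ] Fock, IsUnitaryGroupOf (IsField h) U :=
    ⟨_, isUnitaryGroupOf_weylGroup h⟩
  rw [expI, dif_pos hex, hex.choose_spec.eq_weylGroup]
  rfl

/-! ### Plancherel's theorem for integrable square-integrable functions -/

lemma continuous_fourier_of_integrable {f : ℝ → ℂ} (hf : Integrable f) : Continuous (𝓕 f) :=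
  VectorFourier.fourierIntegral_continuous Real.continuous_fourierChar
    (by exact continuous_inner) hf

/-- The abstract `L²` transform and the integral transform agree as distributions, by moving the
transform onto a test function on each side. -/
lemma fourier_toLp_ae {f : ℝ → ℂ} (hf : Integrable f) (hf2 : MemLp f 2 volume) :
    (𝓕 (hf2.toLp f : Lp ℂ 2 (volume : Measure ℝ)) : Lp ℂ 2 (volume : Measure ℝ)) =ᵐ[volume] 𝓕 f := by
  set F : Lp ℂ 2 (volume : Measure ℝ) := hf2.toLp f
  refine ae_eq_of_integral_contDiff_smul_eq ((Lp.memLp _).locallyIntegrable (by norm_num))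
    (continuous_fourier_of_integrable hf).locallyIntegrable fun g hg hgc => ?_
  have hg₁ : HasCompactSupport (Complex.ofRealCLM ∘ g) := hgc.comp_left rfl
  have hg₂ : ContDiff ℝ (⊤ : ℕ∞) (Complex.ofRealCLM ∘ g) := by fun_prop
  let φ : 𝓢(ℝ, ℂ) := hg₁.toSchwartzMap hg₂
  have h1 : ∫ x, φ x • (𝓕 F : Lp ℂ 2 (volume : Measure ℝ)) x = ∫ x, (𝓕 φ) x • F x := by
    rw [← Lp.toTemperedDistribution_apply, ← Lp.toTemperedDistribution_apply,
      ← Lp.fourier_toTemperedDistribution_eq]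
    rfl
  have h2 : ∫ x, (𝓕 φ) x • F x = ∫ x, (𝓕 φ) x • f x := by
    refine integral_congr_ae ?_
    filter_upwards [hf2.coeFn_toLp] with x hx
    rw [hx]
  have h3 : ∫ x, (𝓕 φ) x • f x = ∫ x, φ x • 𝓕 f x := by
    simpa [SchwartzMap.fourier_coe] using! VectorFourier.integral_fourierIntegral_smul_eq_flip
      (L := innerₗ ℝ) Real.continuous_fourierChar continuous_inner (φ.integrable (μ := volume)) hf
  exact (h1.trans h2).trans h3

lemma memLp_fourier {f : ℝ → ℂ} (hf : Integrable f) (hf2 : MemLp f 2 volume) :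
    MemLp (𝓕 f) 2 volume :=
  (memLp_congr_ae (fourier_toLp_ae hf hf2)).1 (Lp.memLp _)

lemma integral_conj_fourier_mul_fourier {f g : ℝ → ℂ} (hf : Integrable f) (hf2 : MemLp f 2 volume)
    (hg : Integrable g) (hg2 : MemLp g 2 volume) :
    ∫ ξ, (starRingEnd ℂ) (𝓕 f ξ) * 𝓕 g ξ = ∫ x, (starRingEnd ℂ) (f x) * g x := by
  have h := Lp.inner_fourier_eq (hf2.toLp f) (hg2.toLp g)
  rw [L2.inner_def, L2.inner_def] at h
  calc _ = _ := integral_congr_ae (by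
        filter_upwards [fourier_toLp_ae hf hf2, fourier_toLp_ae hg hg2] with ξ h1 h2
        rw [h1, h2, RCLike.inner_apply, mul_comm])
    _ = _ := h
    _ = _ := integral_congr_ae (by
        filter_upwards [hf2.coeFn_toLp, hg2.coeFn_toLp] with ξ h1 h2
        rw [h1, h2, RCLike.inner_apply, mul_comm])

/-! ### Test functions -/

/-- Integrable and square-integrable real functions. -/
structure IsTest (f : ℝ → ℝ) : Prop where
  integrable : Integrable f
  memLp : MemLp f 2 volume

/-- Differentiable functions which, together with their derivative, are integrable and
square-integrable. -/
structure IsDiffTest (g : ℝ → ℝ) : Prop where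
  differentiable : Differentiable ℝ g
  isTest : IsTest g
  isTest_deriv : IsTest (deriv g)

lemma isTest_of_hasCompactSupport {f : ℝ → ℝ} (hf : Continuous f) (hc : HasCompactSupport f) :
    IsTest f :=
  ⟨hf.integrable_of_hasCompactSupport hc, hf.memLp_of_hasCompactSupport hc⟩

lemma isDiffTest_of_hasCompactSupport {f : ℝ → ℝ} (hf : ContDiff ℝ 1 f) (hc : HasCompactSupport f) :
    IsDiffTest f :=
  ⟨hf.differentiable (by norm_num), isTest_of_hasCompactSupport hf.continuous hc,
    isTest_of_hasCompactSupport (hf.continuous_deriv le_rfl) hc.deriv⟩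

lemma isTest_schwartz (f : 𝓢(ℝ, ℝ)) : IsTest f := ⟨f.integrable, f.memLp 2⟩

lemma isDiffTest_schwartz (f : 𝓢(ℝ, ℝ)) : IsDiffTest f :=
  ⟨f.differentiable, isTest_schwartz f, isTest_schwartz (SchwartzMap.derivCLM ℝ ℝ f)⟩

lemma IsTest.hat_memLp {f : ℝ → ℝ} (hf : IsTest f) : MemLp (hat f) 2 volume :=
  memLp_fourier hf.integrable.ofReal hf.memLp.ofReal

lemma IsTest.continuous_hat {f : ℝ → ℝ} (hf : IsTest f) : Continuous (hat f) :=
  continuous_fourier_of_integrable hf.integrable.ofReal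

lemma IsTest.integral_conj_hat_mul_hat {f g : ℝ → ℝ} (hf : IsTest f) (hg : IsTest g) :
    ∫ ξ, (starRingEnd ℂ) (hat f ξ) * hat g ξ = ((∫ x, f x * g x : ℝ) : ℂ) := by
  refine (integral_conj_fourier_mul_fourier (f := fun x => (f x : ℂ)) (g := fun x => (g x : ℂ))
    hf.integrable.ofReal hf.memLp.ofReal hg.integrable.ofReal hg.memLp.ofReal).trans ?_
  rw [← integral_complex_ofReal]
  simp

lemma IsTest.integrable_norm_hat_sq {f : ℝ → ℝ} (hf : IsTest f) :
    Integrable fun ξ => ‖hat f ξ‖ ^ 2 :=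
  (memLp_two_iff_integrable_sq_norm hf.hat_memLp.1).1 hf.hat_memLp

lemma IsTest.integral_norm_hat_sq {f : ℝ → ℝ} (hf : IsTest f) :
    ∫ ξ, ‖hat f ξ‖ ^ 2 = ∫ x, f x ^ 2 := by
  have h := hf.integral_conj_hat_mul_hat hf
  simp_rw [RCLike.conj_mul, ← pow_two (f _)] at h
  have h2 : ∫ ξ, ((‖hat f ξ‖ : ℂ)) ^ 2 = ((∫ ξ, ‖hat f ξ‖ ^ 2 : ℝ) : ℂ) := by
    rw [← integral_complex_ofReal]
    simp
  exact_mod_cast h2.symm.trans h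

lemma hat_neg (f : ℝ → ℝ) (ξ : ℝ) : hat f (-ξ) = (starRingEnd ℂ) (hat f ξ) := by
  rw [hat, Real.fourier_eq, Real.fourier_eq, ← integral_conj]
  congr 1
  ext x
  simp [Circle.smul_def, ← Circle.coe_inv_eq_conj, ← AddChar.map_neg_eq_inv]

lemma IsDiffTest.hat_deriv {g : ℝ → ℝ} (hg : IsDiffTest g) (ξ : ℝ) :
    hat (deriv g) ξ = 2 * Real.pi * Complex.I * ξ * hat g ξ := by
  have hd : ∀ x, HasDerivAt (fun x => (g x : ℂ)) ((deriv g x : ℝ) : ℂ) x := fun x =>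
    (hg.differentiable x).hasDerivAt.ofReal_comp
  have h1 : deriv (fun x => (g x : ℂ)) = fun x => ((deriv g x : ℝ) : ℂ) := funext fun x => (hd x).deriv
  have h2 := Real.fourier_deriv (f := fun x => (g x : ℂ)) hg.isTest.integrable.ofReal
    (fun x => (hd x).differentiableAt) (by rw [h1]; exact hg.isTest_deriv.integrable.ofReal)
  rw [h1] at h2
  simpa [hat] using congrFun h2 ξ

/-! ### One-particle vectors of the time zero fields -/

lemma freq_pos {m : ℝ} (hm : 0 < m) (ξ : ℝ) : 0 < freq m ξ := Real.sqrt_pos.2 (by positivity)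

lemma le_freq (m ξ : ℝ) : m ≤ freq m ξ :=
  Real.le_sqrt_of_sq_le (by nlinarith [sq_nonneg (2 * Real.pi * ξ)])

lemma freq_sq (m ξ : ℝ) : freq m ξ ^ 2 = (2 * Real.pi * ξ) ^ 2 + m ^ 2 :=
  Real.sq_sqrt (by positivity)

lemma freq_neg (m ξ : ℝ) : freq m (-ξ) = freq m ξ := by simp [freq]

lemma continuous_freq (m : ℝ) : Continuous (freq m) := by
  unfold freq
  fun_prop

lemma coeFn_toL2 {u : ℝ → ℂ} (hu : MemLp u 2 volume) : toL2 u =ᵐ[volume] u := by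
  rw [toL2, dif_pos hu]
  exact hu.coeFn_toLp

lemma norm_phiVec_integrand {m : ℝ} (hm : 0 < m) (f : ℝ → ℝ) (ξ : ℝ) :
    ‖hat f ξ / (Real.sqrt (2 * freq m ξ) : ℂ)‖ ^ 2 = ‖hat f ξ‖ ^ 2 / (2 * freq m ξ) := by
  have := freq_pos hm ξ
  rw [norm_div, div_pow, Complex.norm_real, Real.norm_of_nonneg (Real.sqrt_nonneg _),
    Real.sq_sqrt (by positivity)]

lemma norm_phiVec_integrand_le {m : ℝ} (hm : 0 < m) (f : ℝ → ℝ) (ξ : ℝ) :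
    ‖hat f ξ / (Real.sqrt (2 * freq m ξ) : ℂ)‖ ^ 2 ≤ (2 * m)⁻¹ * ‖hat f ξ‖ ^ 2 := by
  rw [norm_phiVec_integrand hm, div_eq_inv_mul]
  have := le_freq m ξ
  gcongr

lemma IsTest.memLp_phiVec {m : ℝ} (hm : 0 < m) {f : ℝ → ℝ} (hf : IsTest f) :
    MemLp (fun ξ => hat f ξ / (Real.sqrt (2 * freq m ξ) : ℂ)) 2 volume := by
  have hmeas : AEStronglyMeasurable (fun ξ => hat f ξ / (Real.sqrt (2 * freq m ξ) : ℂ)) volume := by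
    refine Continuous.aestronglyMeasurable (hf.continuous_hat.div₀ ?_ fun ξ => ?_)
    · have := continuous_freq m
      fun_prop
    · exact_mod_cast (Real.sqrt_pos.2 (mul_pos two_pos (freq_pos hm ξ))).ne'
  rw [memLp_two_iff_integrable_sq_norm hmeas]
  refine (hf.integrable_norm_hat_sq.const_mul (2 * m)⁻¹).mono' (hmeas.norm.pow 2)
    (Eventually.of_forall fun ξ => ?_)
  rw [Real.norm_of_nonneg (by positivity)]
  exact norm_phiVec_integrand_le hm f ξ

lemma norm_piVec_integrand {m : ℝ} (hm : 0 < m) (g : ℝ → ℝ) (ξ : ℝ) :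
    ‖Complex.I * (Real.sqrt (freq m ξ / 2) : ℂ) * hat g ξ‖ ^ 2 = freq m ξ / 2 * ‖hat g ξ‖ ^ 2 := by
  have := freq_pos hm ξ
  rw [norm_mul, norm_mul, mul_pow, mul_pow, Complex.norm_I, Complex.norm_real,
    Real.norm_of_nonneg (Real.sqrt_nonneg _), Real.sq_sqrt (by positivity), one_pow, one_mul]

/-- The relation `ω² = p² + m²`, with `p` acting as differentiation: the source of the gradient and
mass terms in the energy. -/
lemma IsDiffTest.freq_sq_mul {m : ℝ} {g : ℝ → ℝ} (hg : IsDiffTest g) (ξ : ℝ) :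
    freq m ξ ^ 2 * ‖hat g ξ‖ ^ 2 = ‖hat (deriv g) ξ‖ ^ 2 + m ^ 2 * ‖hat g ξ‖ ^ 2 := by
  rw [hg.hat_deriv, freq_sq]
  simp only [norm_mul, Complex.norm_I, Complex.norm_real, mul_pow, Complex.norm_ofNat,
    Real.norm_eq_abs, sq_abs]
  ring

lemma IsDiffTest.memLp_piVec {m : ℝ} (hm : 0 < m) {g : ℝ → ℝ} (hg : IsDiffTest g) :
    MemLp (fun ξ => Complex.I * (Real.sqrt (freq m ξ / 2) : ℂ) * hat g ξ) 2 volume := by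
  have hmeas : AEStronglyMeasurable
      (fun ξ => Complex.I * (Real.sqrt (freq m ξ / 2) : ℂ) * hat g ξ) volume := by
    have h1 := continuous_freq m
    have h2 := hg.isTest.continuous_hat
    exact Continuous.aestronglyMeasurable (by fun_prop)
  rw [memLp_two_iff_integrable_sq_norm hmeas]
  refine ((hg.isTest_deriv.integrable_norm_hat_sq.add
    (hg.isTest.integrable_norm_hat_sq.const_mul (m ^ 2))).add
    hg.isTest.integrable_norm_hat_sq).mono' (hmeas.norm.pow 2) (Eventually.of_forall fun ξ => ?_)
  rw [Real.norm_of_nonneg (by positivity), norm_piVec_integrand hm]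
  simp only [Pi.add_apply]
  rw [← hg.freq_sq_mul]
  -- The elementary bound is `ω/2 ≤ ω² + 1`.
  nlinarith [sq_nonneg ‖hat g ξ‖, sq_nonneg (freq m ξ - 1),
    mul_nonneg (sq_nonneg ‖hat g ξ‖) (sq_nonneg (freq m ξ - 1)),
    mul_nonneg (sq_nonneg ‖hat g ξ‖) (sq_nonneg (freq m ξ))]

lemma IsTest.coeFn_phiVec {m : ℝ} (hm : 0 < m) {f : ℝ → ℝ} (hf : IsTest f) :
    phiVec m f =ᵐ[volume] fun ξ => hat f ξ / (Real.sqrt (2 * freq m ξ) : ℂ) :=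
  coeFn_toL2 (hf.memLp_phiVec hm)

lemma IsDiffTest.coeFn_piVec {m : ℝ} (hm : 0 < m) {g : ℝ → ℝ} (hg : IsDiffTest g) :
    piVec m g =ᵐ[volume] fun ξ => Complex.I * (Real.sqrt (freq m ξ / 2) : ℂ) * hat g ξ :=
  coeFn_toL2 (hg.memLp_piVec hm)

lemma norm_sq_oneParticle (v : OneParticle) : ‖v‖ ^ 2 = ∫ ξ, ‖v ξ‖ ^ 2 := by
  have h : ⟪v, v⟫ = ((∫ ξ, ‖v ξ‖ ^ 2 : ℝ) : ℂ) := by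
    rw [L2.inner_def, ← integral_complex_ofReal]
    congr 1
    ext ξ
    rw [inner_self_eq_norm_sq_to_K]
    simp
  rw [← inner_self_eq_norm_sq (𝕜 := ℂ) v]
  exact congrArg Complex.re h

/-- The mass gap `ω ≥ m` tames the factor `1/(2ω)`. Applied to `h'`, this makes small slopes give
small charge vectors. -/
lemma IsTest.norm_phiVec_sq_le {m : ℝ} (hm : 0 < m) {f : ℝ → ℝ} (hf : IsTest f) :
    ‖phiVec m f‖ ^ 2 ≤ (2 * m)⁻¹ * ∫ x, f x ^ 2 := by
  rw [norm_sq_oneParticle, ← hf.integral_norm_hat_sq, ← integral_const_mul]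
  refine integral_mono_ae
    ((memLp_two_iff_integrable_sq_norm (Lp.aestronglyMeasurable _)).1 (Lp.memLp _))
    (hf.integrable_norm_hat_sq.const_mul _) ?_
  filter_upwards [hf.coeFn_phiVec hm] with ξ hξ
  rw [hξ]
  exact norm_phiVec_integrand_le hm f ξ

/-- The frequency factors `1/√(2ω)` and `√(ω/2)` multiply to `1/2`, leaving a local pairing by
Plancherel. This is the canonical commutation relation at the one-particle level. -/
lemma inner_phiVec_piVec {m : ℝ} (hm : 0 < m) {f g : ℝ → ℝ} (hf : IsTest f) (hg : IsDiffTest g) :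
    ⟪phiVec m f, piVec m g⟫ = Complex.I / 2 * ((∫ x, f x * g x : ℝ) : ℂ) := by
  rw [← hf.integral_conj_hat_mul_hat hg.isTest, ← integral_const_mul, L2.inner_def]
  refine integral_congr_ae ?_
  filter_upwards [hf.coeFn_phiVec hm, hg.coeFn_piVec hm] with ξ h1 h2
  have h0 := freq_pos hm ξ
  rw [h1, h2, RCLike.inner_apply, map_div₀, Complex.conj_ofReal]
  have h3 : Real.sqrt (2 * freq m ξ) = 2 * Real.sqrt (freq m ξ / 2) := by
    rw [show 2 * freq m ξ = 2 ^ 2 * (freq m ξ / 2) by ring, Real.sqrt_mul (by positivity),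
      Real.sqrt_sq two_pos.le]
  have h4 : (Real.sqrt (freq m ξ / 2) : ℂ) ≠ 0 := by
    exact_mod_cast (Real.sqrt_pos.2 (by positivity)).ne'
  rw [h3]
  push_cast
  field_simp

lemma conj_integral_of_symm {F : ℝ → ℂ} (hF : ∀ ξ, F (-ξ) = (starRingEnd ℂ) (F ξ)) :
    (starRingEnd ℂ) (∫ ξ, F ξ) = ∫ ξ, F ξ := by
  rw [← integral_conj, ← integral_neg_eq_self F]
  simp_rw [hF]

/-- For real functions the integrand is conjugated by `ξ ↦ -ξ`. Reality of this product expresses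
that smeared momenta commute, and it makes `π` have zero expectation in dipole states. -/
lemma conj_inner_piVec_piVec {m : ℝ} (hm : 0 < m) {f g : ℝ → ℝ} (hf : IsDiffTest f)
    (hg : IsDiffTest g) :
    (starRingEnd ℂ) ⟪piVec m f, piVec m g⟫ = ⟪piVec m f, piVec m g⟫ := by
  have : ⟪piVec m f, piVec m g⟫ =
      ∫ ξ, (starRingEnd ℂ) (Complex.I * (Real.sqrt (freq m ξ / 2) : ℂ) * hat f ξ) *
      (Complex.I * (Real.sqrt (freq m ξ / 2) : ℂ) * hat g ξ) := by
    rw [L2.inner_def]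
    refine integral_congr_ae ?_
    filter_upwards [hf.coeFn_piVec hm, hg.coeFn_piVec hm] with ξ h1 h2
    rw [h1, h2, RCLike.inner_apply, mul_comm]
  rw [this]
  refine conj_integral_of_symm fun ξ => ?_
  simp [hat_neg, freq_neg]

lemma lintegral_freq_mul_piVec {m : ℝ} (hm : 0 < m) {g : ℝ → ℝ} (hg : IsDiffTest g) :
    ∫⁻ ξ, ENNReal.ofReal (freq m ξ) * ‖piVec m g ξ‖ₑ ^ 2 =
      ENNReal.ofReal (1 / 2 * ∫ x, ((deriv g x) ^ 2 + m ^ 2 * g x ^ 2)) := by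
  have hi := hg.isTest_deriv.integrable_norm_hat_sq
  have hj := hg.isTest.integrable_norm_hat_sq.const_mul (m ^ 2)
  have h1 : (1 / 2 * ∫ x, ((deriv g x) ^ 2 + m ^ 2 * g x ^ 2)) =
      ∫ ξ, 1 / 2 * (‖hat (deriv g) ξ‖ ^ 2 + m ^ 2 * ‖hat g ξ‖ ^ 2) := by
    rw [integral_const_mul, integral_add hi hj, integral_const_mul, hg.isTest.integral_norm_hat_sq,
      hg.isTest_deriv.integral_norm_hat_sq, integral_add, integral_const_mul]
    · exact hg.isTest_deriv.memLp.integrable_sq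
    · exact hg.isTest.memLp.integrable_sq.const_mul _
  have h2 : Integrable fun ξ => 1 / 2 * (‖hat (deriv g) ξ‖ ^ 2 + m ^ 2 * ‖hat g ξ‖ ^ 2) :=
    (hi.add hj).const_mul _
  rw [h1, ofReal_integral_eq_lintegral_ofReal h2 (Eventually.of_forall fun ξ => by positivity)]
  refine lintegral_congr_ae ?_
  filter_upwards [hg.coeFn_piVec hm] with ξ hξ
  rw [hξ, ← ofReal_norm, ← ENNReal.ofReal_pow (norm_nonneg _),
    ← ENNReal.ofReal_mul (freq_pos hm ξ).le, norm_piVec_integrand hm, ← hg.freq_sq_mul]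
  congr 1
  ring

/-! ### Energy of coherent states -/

lemma norm_weylCoeff_zero_sq (f : OneParticle) : ‖weylCoeff f 0‖ ^ 2 = Real.exp (-‖f‖ ^ 2) := by
  rw [weylCoeff, Complex.norm_exp, ← Real.exp_nat_mul, inner_zero_right, sub_zero,
    inner_self_eq_norm_sq_to_K]
  congr 1
  have : (-((‖f‖ : ℝ) : ℂ) ^ 2 / 2) = ((-‖f‖ ^ 2 / 2 : ℝ) : ℂ) := by push_cast; ring
  erw [this, Complex.ofReal_re]
  push_cast
  ring

lemma weyl_vacuum (f : OneParticle) : weyl f vacuum = weylCoeff f 0 • coherent f := by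
  rw [vacuum_eq_coherent, weyl_coherent, zero_add]

lemma dipole_eq (m : ℝ) (g : ℝ → ℝ) :
    dipole m g = weyl ((Complex.I * (Real.sqrt Real.pi : ℝ)) • piVec m g) vacuum := by
  rw [dipole, mom, expI_isField]

lemma lintegral_enorm_sq {n : ℕ} (v : Sector n) : ∫⁻ k, ‖v k‖ₑ ^ 2 = ENNReal.ofReal (‖v‖ ^ 2) := by
  have h1 := Lp.enorm_def v
  rw [eLpNorm_eq_lintegral_rpow_enorm_toReal (by norm_num) (by norm_num)] at h1
  simp only [ENNReal.toReal_ofNat, ENNReal.rpow_ofNat, one_div] at h1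
  have h2 : ‖v‖ₑ ^ 2 = ∫⁻ k, ‖v k‖ₑ ^ 2 := by
    rw [h1, ← ENNReal.rpow_natCast, ← ENNReal.rpow_mul]
    norm_num
  rw [← h2, ← ofReal_norm, ENNReal.ofReal_pow (norm_nonneg _)]

lemma enorm_finset_prod {ι : Type*} (s : Finset ι) (z : ι → ℂ) :
    ‖∏ i ∈ s, z i‖ₑ = ∏ i ∈ s, ‖z i‖ₑ := by
  simp only [← ofReal_norm, norm_prod]
  exact ENNReal.ofReal_prod_of_nonneg fun i _ => norm_nonneg _

lemma lintegral_prod_enorm_sq (f : OneParticle) (n : ℕ) :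
    ∫⁻ k : Fin n → ℝ, ∏ i, ‖f (k i)‖ₑ ^ 2 = ENNReal.ofReal ((‖f‖ ^ 2) ^ n) := by
  rw [← pow_mul, mul_comm, pow_mul, ← norm_tensorPow, ← lintegral_enorm_sq]
  refine lintegral_congr_ae ?_
  filter_upwards [coeFn_tensor fun _ : Fin n => f] with k hk
  rw [tensorPow_eq_tensor, hk, enorm_finset_prod, Finset.prod_pow]

lemma lintegral_freq_mul_prod {m : ℝ} (f : OneParticle) {n : ℕ} (j : Fin (n + 1)) :
    ∫⁻ k : Fin (n + 1) → ℝ, ENNReal.ofReal (freq m (k j)) * ∏ i, ‖f (k i)‖ₑ ^ 2 =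
      (∫⁻ ξ, ENNReal.ofReal (freq m ξ) * ‖f ξ‖ₑ ^ 2) * ENNReal.ofReal ((‖f‖ ^ 2) ^ n) := by
  have mp := volume_preserving_piFinSuccAbove (fun _ : Fin (n + 1) => ℝ) j
  have hm1 : AEMeasurable (fun ξ => ENNReal.ofReal (freq m ξ) * ‖f ξ‖ₑ ^ 2) volume :=
    ((continuous_freq m).measurable.ennreal_ofReal.aemeasurable).mul
      ((Lp.aestronglyMeasurable f).enorm.pow_const 2)
  have hm2 : AEMeasurable (fun k : Fin n → ℝ => ∏ i, ‖f (k i)‖ₑ ^ 2) volume :=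
    Finset.aemeasurable_fun_prod _ fun i _ => ((Lp.aestronglyMeasurable f).comp_quasiMeasurePreserving
      (Measure.quasiMeasurePreserving_eval (fun _ : Fin n => (volume : Measure ℝ)) i)).enorm.pow_const 2
  rw [← lintegral_prod_enorm_sq, ← lintegral_prod_mul hm1 hm2]
  refine Eq.trans ?_ (mp.lintegral_comp_emb (MeasurableEquiv.measurableEmbedding _) _)
  refine lintegral_congr fun k => ?_
  have : MeasurableEquiv.piFinSuccAbove (fun _ : Fin (n + 1) => ℝ) j k =
    (k j, fun i => k (j.succAbove i)) := rfl
  rw [this, Fin.prod_univ_succAbove _ j, mul_assoc]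

/-- The `n + 1` particles contribute equally, and this factor lowers `(n + 1)!` to `n!`. The
remaining weights then sum to an exponential. -/
lemma lintegral_sector_energy {m : ℝ} (hm : 0 < m) (c : ℂ) (f : OneParticle) (n : ℕ) :
    ∫⁻ k : Fin (n + 1) → ℝ, ENNReal.ofReal (∑ j, freq m (k j)) *
        ‖wave (c • coherent f) (n + 1) k‖ₑ ^ 2 =
      (∫⁻ ξ, ENNReal.ofReal (freq m ξ) * ‖f ξ‖ₑ ^ 2) *
        ENNReal.ofReal (‖c‖ ^ 2 * ((‖f‖ ^ 2) ^ n / n.factorial)) := by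
  have h1 : ∀ᵐ k : Fin (n + 1) → ℝ, ENNReal.ofReal (∑ j, freq m (k j)) *
      ‖wave (c • coherent f) (n + 1) k‖ₑ ^ 2 = (‖c‖ₑ ^ 2 * ‖coeffFact (n + 1)‖ₑ ^ 2) *
        ∑ j, ENNReal.ofReal (freq m (k j)) * ∏ i, ‖f (k i)‖ₑ ^ 2 := by
    filter_upwards [wave_smul c (coherent f) (n + 1), wave_coherent f (n + 1)] with k h1 h2
    rw [h1, h2, ENNReal.ofReal_sum_of_nonneg fun j _ => (freq_pos hm _).le, ← Finset.sum_mul,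
      enorm_mul, enorm_mul, enorm_finset_prod, Finset.prod_pow]
    ring
  have hm2 : ∀ j : Fin (n + 1), AEMeasurable (fun k : Fin (n + 1) → ℝ =>
      ENNReal.ofReal (freq m (k j)) * ∏ i, ‖f (k i)‖ₑ ^ 2) volume := fun j =>
    (((continuous_freq m).comp (continuous_apply j)).measurable.ennreal_ofReal.aemeasurable).mul
      (Finset.aemeasurable_fun_prod _ fun i _ =>
        ((Lp.aestronglyMeasurable f).comp_quasiMeasurePreserving
        (Measure.quasiMeasurePreserving_eval (fun _ : Fin (n + 1) => (volume : Measure ℝ)) i)).enorm.pow_const 2)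
  have h2 : ‖c‖ₑ ^ 2 * ‖coeffFact (n + 1)‖ₑ ^ 2 * (((n + 1 : ℕ) : ℝ≥0∞) *
      ENNReal.ofReal ((‖f‖ ^ 2) ^ n)) = ENNReal.ofReal (‖c‖ ^ 2 * ((‖f‖ ^ 2) ^ n / n.factorial)) := by
    rw [← ofReal_norm, ← ofReal_norm, ← ENNReal.ofReal_pow (norm_nonneg _),
      ← ENNReal.ofReal_pow (norm_nonneg _), ← ENNReal.ofReal_natCast (n + 1),
      ← ENNReal.ofReal_mul (by positivity), ← ENNReal.ofReal_mul (by positivity),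
      ← ENNReal.ofReal_mul (by positivity)]
    congr 1
    rw [norm_coeffFact, inv_pow, Real.sq_sqrt (by positivity), Nat.factorial_succ]
    push_cast
    field_simp
  rw [lintegral_congr_ae h1, lintegral_const_mul' _ _ (by finiteness),
    lintegral_finsetSum' _ fun j _ => hm2 j,
    Finset.sum_congr rfl fun j _ => lintegral_freq_mul_prod f j, Finset.sum_const,
    Finset.card_univ, Fintype.card_fin, nsmul_eq_mul, ← h2]
  ring

lemma energyForm_smul_coherent {m : ℝ} (hm : 0 < m) (c : ℂ) (f : OneParticle)
    (hc : ‖c‖ ^ 2 = Real.exp (-‖f‖ ^ 2)) :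
    energyForm m (c • coherent f) = ∫⁻ ξ, ENNReal.ofReal (freq m ξ) * ‖f ξ‖ₑ ^ 2 := by
  -- The vacuum sector is split off: its energy is an empty sum.
  rw [energyForm, tsum_eq_zero_add' ENNReal.summable]
  simp_rw [lintegral_sector_energy hm]
  rw [ENNReal.tsum_mul_left, ← ENNReal.ofReal_tsum_of_nonneg (fun n => by positivity)
    ((Real.summable_pow_div_factorial _).mul_left _), tsum_mul_left, hc]
  have : ∑' n : ℕ, (‖f‖ ^ 2) ^ n / n.factorial = Real.exp (‖f‖ ^ 2) := by
    rw [Real.exp_eq_exp_ℝ, NormedSpace.exp_eq_tsum_div]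
  rw [this, ← Real.exp_add]
  simp

lemma energyForm_dipole {m : ℝ} (hm : 0 < m) {g : ℝ → ℝ} (hg : IsDiffTest g) :
    energyForm m (dipole m g) =
      ENNReal.ofReal (Real.pi / 2 * ∫ x, ((deriv g x) ^ 2 + m ^ 2 * g x ^ 2)) := by
  rw [dipole_eq, weyl_vacuum, energyForm_smul_coherent hm _ _ (norm_weylCoeff_zero_sq _)]
  have h1 : ∀ᵐ ξ, ENNReal.ofReal (freq m ξ) *
      ‖((Complex.I * (Real.sqrt Real.pi : ℝ)) • piVec m g : OneParticle) ξ‖ₑ ^ 2 =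
      ENNReal.ofReal Real.pi * (ENNReal.ofReal (freq m ξ) * ‖piVec m g ξ‖ₑ ^ 2) := by
    filter_upwards [Lp.coeFn_smul (Complex.I * (Real.sqrt Real.pi : ℝ)) (piVec m g)] with ξ hξ
    have h2 : ‖(Complex.I * (Real.sqrt Real.pi : ℝ) : ℂ)‖ₑ ^ 2 = ENNReal.ofReal Real.pi := by
      rw [← ofReal_norm, ← ENNReal.ofReal_pow (norm_nonneg _)]
      congr 1
      rw [norm_mul, Complex.norm_I, one_mul, Complex.norm_real, Real.norm_eq_abs, sq_abs,
        Real.sq_sqrt Real.pi_pos.le]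
    rw [hξ, Pi.smul_apply, smul_eq_mul, enorm_mul, mul_pow, h2]
    ring
  rw [lintegral_congr_ae h1, lintegral_const_mul' _ _ (by finiteness),
    lintegral_freq_mul_piVec hm hg, ← ENNReal.ofReal_mul Real.pi_pos.le]
  congr 1
  ring

/-! ### Wick squares in coherent states -/

/-- Obtained by differentiating the kernel `exp ⟪u, f + s h⟫` at `s = 0`, which avoids sums over
sectors. A further derivative, in the left argument, gives `inner_creation_creation`. -/
lemma inner_coherent_creation (u h f : OneParticle) :
    ⟪coherent u, creation h f⟫ = ⟪u, h⟫ * Complex.exp ⟪u, f⟫ := by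
  have h1 : HasDerivAt (fun s : ℝ => coherent (f + (s : ℂ) • h)) (creation h f) 0 := by
    have := HasDerivAt.scomp (0 : ℝ) (by simpa using hasDerivAt_coherent h f)
      (Complex.ofRealCLM.hasDerivAt (x := (0 : ℝ)))
    exact (by simpa using this :
      HasDerivAt ((fun z : ℂ => coherent (f + z • h)) ∘ Complex.ofRealCLM) (creation h f) 0)
  have h2 := (hasDerivAt_const (0 : ℝ) (coherent u)).inner ℂ h1
  simp only [inner_coherent, inner_zero_left, add_zero] at h2
  have h3 : HasDerivAt (fun s : ℝ => Complex.exp (⟪u, f⟫ + (s : ℂ) * ⟪u, h⟫))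
      (⟪u, h⟫ * Complex.exp ⟪u, f⟫) 0 := by
    have := (((Complex.ofRealCLM.hasDerivAt (x := (0 : ℝ))).mul_const ⟪u, h⟫).const_add ⟪u, f⟫).cexp
    simpa [mul_comm] using this
  simp_rw [inner_add_right, inner_smul_right] at h2
  exact h2.unique h3

lemma inner_creation_creation (h f g : OneParticle) :
    ⟪creation h f, creation h g⟫ = (⟪h, h⟫ + ⟪f, h⟫ * ⟪h, g⟫) * Complex.exp ⟪f, g⟫ := by
  have h1 : HasDerivAt (fun s : ℝ => coherent (f + (s : ℂ) • h)) (creation h f) 0 := by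
    have := HasDerivAt.scomp (0 : ℝ) (by simpa using hasDerivAt_coherent h f)
      (Complex.ofRealCLM.hasDerivAt (x := (0 : ℝ)))
    exact (by simpa using this :
      HasDerivAt ((fun z : ℂ => coherent (f + z • h)) ∘ Complex.ofRealCLM) (creation h f) 0)
  have h2 := h1.inner ℂ (hasDerivAt_const (0 : ℝ) (creation h g))
  simp only [inner_coherent_creation, inner_zero_right, zero_add, inner_add_left, inner_smul_left,
    Complex.conj_ofReal] at h2
  have h3 : HasDerivAt (fun s : ℝ => (⟪f, h⟫ + (s : ℂ) * ⟪h, h⟫) *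
      Complex.exp (⟪f, g⟫ + (s : ℂ) * ⟪h, g⟫))
      ((⟪h, h⟫ + ⟪f, h⟫ * ⟪h, g⟫) * Complex.exp ⟪f, g⟫) 0 := by
    have h4 := Complex.ofRealCLM.hasDerivAt (x := (0 : ℝ))
    have := ((h4.mul_const ⟪h, h⟫).const_add ⟪f, h⟫).mul
      ((h4.mul_const ⟪h, g⟫).const_add ⟪f, g⟫).cexp
    refine this.congr_deriv ?_
    simp only [Complex.ofRealCLM_apply, Complex.ofReal_zero, Complex.ofReal_one, zero_mul, one_mul,
      add_zero]
    ring
  exact h2.unique h3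

lemma norm_fieldCoherent_sq (h f : OneParticle) :
    ‖fieldCoherent h f‖ ^ 2 = (‖h‖ ^ 2 + (2 * (⟪h, f⟫).re) ^ 2) * Real.exp (‖f‖ ^ 2) := by
  have hre : ((2 * (⟪h, f⟫).re : ℝ) : ℂ) = ⟪h, f⟫ + ⟪f, h⟫ := by
    rw [← inner_conj_symm f h, Complex.add_conj]
  have hn : ∀ v : OneParticle, ((‖v‖ ^ 2 : ℝ) : ℂ) = ⟪v, v⟫ := fun v => by
    rw [inner_self_eq_norm_sq_to_K]
    push_cast
    rfl
  have h1 : ((‖fieldCoherent h f‖ ^ 2 : ℝ) : ℂ) = ⟪fieldCoherent h f, fieldCoherent h f⟫ := by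
    rw [inner_self_eq_norm_sq_to_K]
    push_cast
    rfl
  have h2 : ⟪creation h f, coherent f⟫ = ⟪h, f⟫ * Complex.exp ⟪f, f⟫ := by
    rw [← inner_conj_symm, inner_coherent_creation, map_mul, inner_conj_symm, ← Complex.exp_conj,
      inner_conj_symm]
  refine Complex.ofReal_injective ?_
  rw [h1, Complex.ofReal_mul, Complex.ofReal_add, Complex.ofReal_exp, hn, hn,
    Complex.ofReal_pow _ 2, hre, fieldCoherent, inner_add_left, inner_add_right, inner_add_right, inner_smul_left,
    inner_smul_right, inner_smul_left, inner_smul_right, inner_conj_symm, h2, inner_coherent,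
    inner_coherent_creation, inner_creation_creation]
  ring

/-- A coherent state shifts the field by its expectation `2 Re ⟪h, f⟫` without changing its
fluctuation `‖h‖²`; the vacuum subtraction removes the latter exactly. -/
lemma hasWickSquare_weyl_vacuum (h f : OneParticle) :
    HasWickSquare (IsField h) (weyl f vacuum) ((2 * (⟪h, f⟫).re) ^ 2) := by
  refine ⟨_, _, weyl_vacuum f ▸ (isField_coherent h f).smul (weylCoeff f 0),
    vacuum_eq_coherent ▸ isField_coherent h 0, ?_⟩
  rw [norm_smul, mul_pow ‖weylCoeff f 0‖, norm_weylCoeff_zero_sq, norm_fieldCoherent_sq, norm_fieldCoherent_sq,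
    inner_zero_right]
  have : Real.exp (-‖f‖ ^ 2) * Real.exp (‖f‖ ^ 2) = 1 := by rw [← Real.exp_add]; simp
  simp only [norm_zero, Complex.zero_re, mul_zero, ne_eq, OfNat.ofNat_ne_zero, not_false_eq_true,
    zero_pow, Real.exp_zero, add_zero, mul_one]
  linear_combination -(‖h‖ ^ 2 + (2 * (⟪h, f⟫).re) ^ 2) * this

lemma hasWickSquare_mom_dipole {m : ℝ} (hm : 0 < m) {u g : ℝ → ℝ} (hu : IsDiffTest u)
    (hg : IsDiffTest g) : HasWickSquare (mom m u) (dipole m g) 0 := by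
  rw [dipole_eq, mom]
  convert hasWickSquare_weyl_vacuum (piVec m u) _ using 1
  have h1 := Complex.conj_eq_iff_im.1 (conj_inner_piVec_piVec hm hu hg)
  rw [inner_smul_right]
  simp [h1]

lemma hasWickSquare_phi_dipole {m : ℝ} (hm : 0 < m) {u g : ℝ → ℝ} (hu : IsTest u)
    (hg : IsDiffTest g) :
    HasWickSquare (phi m u) (dipole m g) (Real.pi * (∫ x, u x * g x) ^ 2) := by
  rw [dipole_eq, phi]
  convert hasWickSquare_weyl_vacuum (phiVec m u) _ using 1
  rw [inner_smul_right, inner_phiVec_piVec hm hu hg]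
  have : Complex.I * (Real.sqrt Real.pi : ℝ) * (Complex.I / 2 * ((∫ x, u x * g x : ℝ) : ℂ)) =
      ((-(Real.sqrt Real.pi / 2 * ∫ x, u x * g x) : ℝ) : ℂ) := by
    push_cast
    linear_combination (Real.sqrt Real.pi : ℂ) / 2 * ((∫ x, u x * g x : ℝ) : ℂ) * Complex.I_mul_I
  rw [this, Complex.ofReal_re]
  nlinarith [Real.sq_sqrt Real.pi_pos.le]

/-! ### The energy density -/

lemma hasCompactSupport_bump {ρ : ℝ → ℝ} (hρ : HasCompactSupport ρ) {δ : ℝ} (hδ : 0 < δ) (x : ℝ) :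
    HasCompactSupport (bump ρ δ x) := by
  have h := hρ.comp_homeomorph ((Homeomorph.subRight x).trans (Homeomorph.mulRight₀ δ⁻¹ (by positivity)))
  have : bump ρ δ x = fun y => δ⁻¹ * (ρ ∘ ((Homeomorph.subRight x).trans
      (Homeomorph.mulRight₀ δ⁻¹ (by positivity)))) y := by
    ext y
    simp [bump, div_eq_mul_inv]
  rw [this]
  exact h.mul_left

lemma contDiff_bump {ρ : ℝ → ℝ} (hρ : ContDiff ℝ (⊤ : ℕ∞) ρ) (δ x : ℝ) :
    ContDiff ℝ (⊤ : ℕ∞) (bump ρ δ x) := by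
  unfold bump
  exact contDiff_const.mul (hρ.comp ((contDiff_id.sub contDiff_const).div_const δ))

lemma integral_bump_mul (ρ u : ℝ → ℝ) {δ : ℝ} (hδ : 0 < δ) (x : ℝ) :
    ∫ y, bump ρ δ x y * u y = ∫ z, ρ z * u (x + δ * z) := by
  have h1 := Measure.integral_comp_mul_left (fun y => bump ρ δ x (x + y) * u (x + y)) δ
  rw [integral_add_left_eq_self (fun y => bump ρ δ x y * u y) x, smul_eq_mul,
    abs_of_pos (by positivity)] at h1
  have h2 : ∀ z, bump ρ δ x (x + δ * z) * u (x + δ * z) = δ⁻¹ * (ρ z * u (x + δ * z)) := fun z => by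
    rw [bump, add_sub_cancel_left, mul_div_cancel_left₀ _ hδ.ne', mul_assoc]
  simp_rw [h2] at h1
  rw [integral_const_mul] at h1
  exact (mul_left_cancel₀ (by positivity) h1).symm

lemma tendsto_integral_bump_mul {ρ u : ℝ → ℝ} (hρ : Continuous ρ) (hc : HasCompactSupport ρ)
    (h1 : ∫ y, ρ y = 1) (hu : Continuous u) (x : ℝ) :
    Tendsto (fun δ => ∫ y, bump ρ δ x y * u y) (𝓝[>] 0) (𝓝 (u x)) := by
  have hset : ∀ v : ℝ → ℝ, ∫ z in tsupport ρ, ρ z * v z = ∫ z, ρ z * v z := fun v =>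
    setIntegral_eq_integral_of_forall_compl_eq_zero fun z hz => by
      rw [image_eq_zero_of_notMem_tsupport hz, zero_mul]
  have hcont : Continuous fun δ : ℝ => ∫ z in tsupport ρ, ρ z * u (x + δ * z) :=
    -- After rescaling, `δ` enters only through `u (x + δ z)` with `z` in a fixed compact set, so
    -- the limit is continuity at `δ = 0`; `ρ` need not be nonnegative.
    continuous_parametric_integral_of_continuous (by fun_prop) hc
  have h2 := hcont.tendsto 0
  simp_rw [hset fun z => u (x + _ * z)] at h2
  simp only [zero_mul, add_zero, integral_mul_const, h1, one_mul] at h2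
  refine (h2.mono_left nhdsWithin_le_nhds).congr' ?_
  filter_upwards [self_mem_nhdsWithin] with δ hδ
  exact (integral_bump_mul ρ u hδ x).symm

lemma integral_neg_deriv_mul {b g : ℝ → ℝ} (hb : IsDiffTest b) (hg : IsDiffTest g) :
    ∫ y, -deriv b y * g y = ∫ y, b y * deriv g y := by
  rw [integral_mul_deriv_eq_deriv_mul_of_integrable (u := b) (v := g) (u' := deriv b)
    (v' := deriv g) (fun x _ => (hb.differentiable x).hasDerivAt)
    (fun x _ => (hg.differentiable x).hasDerivAt) (hb.isTest.memLp.integrable_mul hg.isTest_deriv.memLp)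
    (hb.isTest_deriv.memLp.integrable_mul hg.isTest.memLp)
    (hb.isTest.memLp.integrable_mul hg.isTest.memLp), ← integral_neg]
  simp_rw [neg_mul]

lemma hasEnergyDensity_dipole {m : ℝ} (hm : 0 < m) {g : ℝ → ℝ} (hg : IsDiffTest g)
    (hg1 : ContDiff ℝ 1 g) (x : ℝ) :
    HasEnergyDensity m (dipole m g) x (Real.pi / 2 * ((deriv g x) ^ 2 + m ^ 2 * g x ^ 2)) := by
  intro ρ hρ hc h1
  have hb : ∀ δ > 0, IsDiffTest (bump ρ δ x) := fun δ hδ =>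
    isDiffTest_of_hasCompactSupport ((contDiff_bump hρ δ x).of_le (by exact_mod_cast le_top))
      (hasCompactSupport_bump hc hδ x)
  refine ⟨fun _ => 0, fun δ => Real.pi * (∫ y, -deriv (bump ρ δ x) y * g y) ^ 2,
    fun δ => Real.pi * (∫ y, bump ρ δ x y * g y) ^ 2, fun δ hδ => ⟨?_, ?_, ?_⟩, ?_⟩
  · exact hasWickSquare_mom_dipole hm (hb δ hδ) hg
  · have hd := (hb δ hδ).isTest_deriv
    exact hasWickSquare_phi_dipole hm ⟨hd.integrable.neg, hd.memLp.neg⟩ hg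
  · exact hasWickSquare_phi_dipole hm (hb δ hδ).isTest hg
  · have h2 := tendsto_integral_bump_mul hρ.continuous hc h1 hg1.continuous x
    have h3 := tendsto_integral_bump_mul hρ.continuous hc h1 (hg1.continuous_deriv le_rfl) x
    have h4 : Tendsto (fun δ => ∫ y, -deriv (bump ρ δ x) y * g y) (𝓝[>] 0) (𝓝 (deriv g x)) := by
      refine h3.congr' ?_
      filter_upwards [self_mem_nhdsWithin] with δ hδ
      exact (integral_neg_deriv_mul (hb δ hδ) hg).symm
    have h5 := (((h4.pow 2).const_mul Real.pi).add
      (((h2.pow 2).const_mul Real.pi).const_mul (m ^ 2))).const_mul (1 / 2)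
    refine (h5.congr fun δ => ?_).trans_eq ?_
    · ring
    · congr 1
      ring

lemma IsDipoleProfile.hasCompactSupport {ε R : ℝ} {g : ℝ → ℝ} (hg : IsDipoleProfile ε R g) :
    HasCompactSupport g :=
  HasCompactSupport.intro (isCompact_Icc (a := -ε) (b := R + ε)) fun x hx => by
    refine hg.eq_zero x ?_
    by_contra! h
    exact hx ⟨h.1.le, h.2.le⟩

lemma IsDipoleProfile.isDiffTest {ε R : ℝ} {g : ℝ → ℝ} (hg : IsDipoleProfile ε R g) :
    IsDiffTest g := isDiffTest_of_hasCompactSupport hg.contDiff hg.hasCompactSupport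

/-! ### Weyl operators of small one-particle vectors -/

lemma weyl_mul_comm (u v : OneParticle) :
    weyl u * weyl v = Complex.exp (⟪v, u⟫ - ⟪u, v⟫) • (weyl v * weyl u) := by
  rw [weyl_mul, weyl_mul, smul_smul, ← Complex.exp_add, add_comm v u]
  congr 2
  ring

lemma norm_weyl_le (u : OneParticle) : ‖weyl u‖ ≤ 1 :=
  ContinuousLinearMap.opNorm_le_bound _ zero_le_one fun ψ => by rw [norm_weyl_apply, one_mul]

lemma norm_vacuum : ‖vacuum‖ = 1 := by
  have h : ⟪vacuum, vacuum⟫ = 1 := by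
    rw [vacuum_eq_coherent, inner_coherent]
    simp
  have h2 := congrArg Complex.re h
  rw [← sq_eq_sq₀ (norm_nonneg _) zero_le_one, ← inner_self_eq_norm_sq (𝕜 := ℂ)]
  simpa using h2

lemma norm_weyl_vacuum_sub_sq (u : OneParticle) :
    ‖weyl u vacuum - vacuum‖ ^ 2 = 2 - 2 * Real.exp (-‖u‖ ^ 2 / 2) := by
  have h1 : ⟪weyl u vacuum, vacuum⟫ = ((Real.exp (-‖u‖ ^ 2 / 2) : ℝ) : ℂ) := by
    rw [weyl_vacuum, vacuum_eq_coherent, inner_smul_left, inner_coherent, weylCoeff,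
      ← Complex.exp_conj]
    simp only [inner_zero_right, sub_zero, Complex.exp_zero, mul_one, map_div₀, map_neg,
      inner_conj_symm, Complex.conj_ofNat]
    rw [inner_self_eq_norm_sq_to_K, Complex.ofReal_exp]
    push_cast
    rfl
  rw [norm_sub_sq (𝕜 := ℂ), h1, norm_weyl_apply, norm_vacuum, RCLike.re_to_complex,
    Complex.ofReal_re]
  ring

lemma tendsto_weyl_vacuum {u : ℕ → OneParticle} (hu : Tendsto u atTop (𝓝 0)) :
    Tendsto (fun n => ‖weyl (u n) vacuum - vacuum‖) atTop (𝓝 0) := by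
  have h1 : Tendsto (fun n => 2 - 2 * Real.exp (-‖u n‖ ^ 2 / 2)) atTop (𝓝 0) := by
    have hc : Continuous fun v : OneParticle => 2 - 2 * Real.exp (-‖v‖ ^ 2 / 2) := by fun_prop
    simpa [Function.comp_def] using (hc.tendsto 0).comp hu
  simp_rw [← norm_weyl_vacuum_sub_sq] at h1
  have h2 := h1.sqrt
  simpa [Real.sqrt_sq] using h2

/-- The bounded operators which asymptotically commute in norm with Weyl operators of vectors that
tend to zero. -/
def AsympCommutes (B : Fock →L[ℂ] Fock) : Prop :=
  ∀ u : ℕ → OneParticle, Tendsto u atTop (𝓝 0) →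
    Tendsto (fun n => weyl (u n) * B - B * weyl (u n)) atTop (𝓝 0)

lemma asympCommutes_weyl (v : OneParticle) : AsympCommutes (weyl v) := by
  intro u hu
  have h1 : Tendsto (fun n => Complex.exp (⟪v, u n⟫ - ⟪u n, v⟫) - 1) atTop (𝓝 0) := by
    have hc : Continuous fun w : OneParticle => Complex.exp (⟪v, w⟫ - ⟪w, v⟫) - 1 := by fun_prop
    simpa [Function.comp_def] using (hc.tendsto 0).comp hu
  refine squeeze_zero_norm (fun n => ?_) (by simpa using h1.norm)
  rw [weyl_mul_comm (u n) v]
  have : Complex.exp (⟪v, u n⟫ - ⟪u n, v⟫) • (weyl v * weyl (u n)) - weyl v * weyl (u n) =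
      (Complex.exp (⟪v, u n⟫ - ⟪u n, v⟫) - 1) • (weyl v * weyl (u n)) := by
    rw [sub_smul, one_smul]
  rw [this, norm_smul]
  refine mul_le_of_le_one_right (norm_nonneg _) ((norm_mul_le _ _).trans ?_)
  exact mul_le_one₀ (norm_weyl_le _) (norm_nonneg _) (norm_weyl_le _)

lemma AsympCommutes.star {B : Fock →L[ℂ] Fock} (hB : AsympCommutes B) :
    AsympCommutes (star B) := by
  intro u hu
  -- Adjoints of Weyl operators are those of the negated vectors, which also tend to zero.
  have h := (hB (fun n => -u n) (by simpa using hu.neg)).star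
  rw [star_zero] at h
  refine (h.neg.congr fun n => ?_).trans_eq (by rw [neg_zero])
  rw [star_sub, star_mul, star_mul, star_weyl, neg_neg, neg_sub]

lemma AsympCommutes.mul {B C : Fock →L[ℂ] Fock} (hB : AsympCommutes B) (hC : AsympCommutes C) :
    AsympCommutes (B * C) := by
  intro u hu
  have h := ((hB u hu).mul_const C).add ((hC u hu).const_mul B)
  rw [zero_mul, mul_zero, add_zero] at h
  refine h.congr fun n => ?_
  noncomm_ring

lemma AsympCommutes.add {B C : Fock →L[ℂ] Fock} (hB : AsympCommutes B) (hC : AsympCommutes C) :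
    AsympCommutes (B + C) := by
  intro u hu
  have h := (hB u hu).add (hC u hu)
  rw [add_zero] at h
  refine h.congr fun n => ?_
  noncomm_ring

lemma asympCommutes_algebraMap (c : ℂ) : AsympCommutes (algebraMap ℂ (Fock →L[ℂ] Fock) c) := by
  intro u _
  simp_rw [← Algebra.commutes c, sub_self]
  exact tendsto_const_nhds

lemma isClosed_asympCommutes : IsClosed {B | AsympCommutes B} := by
  refine isClosed_of_closure_subset fun B hB u hu => ?_
  rw [Metric.mem_closure_iff] at hB
  rw [Metric.tendsto_atTop]
  intro ε hε
  obtain ⟨C, hC, hd⟩ := hB (ε / 4) (by positivity)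
  obtain ⟨N, hN⟩ := Metric.tendsto_atTop.1 (hC u hu) (ε / 4) (by positivity)
  refine ⟨N, fun n hn => ?_⟩
  have h1 := hN n hn
  rw [dist_zero_right] at h1 ⊢
  rw [dist_eq_norm] at hd
  have h2 : weyl (u n) * B - B * weyl (u n) = weyl (u n) * (B - C) +
      (weyl (u n) * C - C * weyl (u n)) - (B - C) * weyl (u n) := by noncomm_ring
  have h3 : ‖weyl (u n) * (B - C)‖ ≤ ‖B - C‖ :=
    (norm_mul_le _ _).trans (mul_le_of_le_one_left (norm_nonneg _) (norm_weyl_le _))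
  have h4 : ‖(B - C) * weyl (u n)‖ ≤ ‖B - C‖ :=
    (norm_mul_le _ _).trans (mul_le_of_le_one_right (norm_nonneg _) (norm_weyl_le _))
  rw [h2]
  calc _ ≤ ‖weyl (u n) * (B - C)‖ + ‖weyl (u n) * C - C * weyl (u n)‖ + ‖(B - C) * weyl (u n)‖ :=
        (norm_sub_le _ _).trans (by gcongr; exact norm_add_le _ _)
    _ < ε := by linarith

lemma weylPhi_eq (m : ℝ) (f : SZero) : weylPhi m f = weyl (Complex.I • phiVec m f.1) := by
  rw [weylPhi, phi, expI_isField]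
  simp

lemma weylPi_eq (m : ℝ) (g : SZero) : weylPi m g = weyl (Complex.I • piVec m g.1) := by
  rw [weylPi, mom, expI_isField]
  simp

/-- For Weyl operators the commutator is a phase tending to `1`. The property passes to the
generated star algebra, and to its norm closure because Weyl operators are contractions. -/
lemma asympCommutes_of_mem {m : ℝ} {B : Fock →L[ℂ] Fock} (hB : B ∈ weylAlgebra m) :
    AsympCommutes B := by
  have h1 : ∀ C ∈ StarAlgebra.adjoin ℂ (Set.range (weylPhi m) ∪ Set.range (weylPi m)),
      AsympCommutes C := by
    intro C hC
    induction hC using StarAlgebra.adjoin_induction with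
    | mem x hx =>
      rcases hx with ⟨f, rfl⟩ | ⟨g, rfl⟩
      · rw [weylPhi_eq]
        exact asympCommutes_weyl _
      · rw [weylPi_eq]
        exact asympCommutes_weyl _
    | algebraMap c => exact asympCommutes_algebraMap c
    | add x y _ _ hx hy => exact hx.add hy
    | mul x y _ _ hx hy => exact hx.mul hy
    | star x _ hx => exact hx.star
  have h2 : B ∈ closure (StarAlgebra.adjoin ℂ (Set.range (weylPhi m) ∪ Set.range (weylPi m)) :
      Set (Fock →L[ℂ] Fock)) := by
    rw [← StarSubalgebra.topologicalClosure_coe]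
    exact hB
  exact closure_minimal h1 isClosed_asympCommutes h2

/-! ### The charge of the dipole states -/

/-- The one-particle vector of the Weyl operator `exp(i s Q_h)`. -/
def chargeVec (m s : ℝ) (h : 𝓢(ℝ, ℝ)) : OneParticle :=
  Complex.I • phiVec m (derivTest (s / Real.sqrt Real.pi) h).1

lemma coe_expCharge (m s : ℝ) (h : 𝓢(ℝ, ℝ)) :
    (expCharge m s h : Fock →L[ℂ] Fock) = weyl (chargeVec m s h) := weylPhi_eq _ _

lemma derivTest_apply (c : ℝ) (h : 𝓢(ℝ, ℝ)) (x : ℝ) : (derivTest c h).1 x = c * deriv h x := rfl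

lemma IsChargeCutoff.tendsto_chargeVec {m : ℝ} (hm : 0 < m) {h : ℕ → 𝓢(ℝ, ℝ)}
    (hh : IsChargeCutoff h) (s : ℝ) :
    Tendsto (fun n => chargeVec m s (h n)) atTop (𝓝 0) := by
  have h1 : ∀ n, ‖chargeVec m s (h n)‖ ^ 2 ≤
      (2 * m)⁻¹ * ((s / Real.sqrt Real.pi) ^ 2 * ∫ x, (deriv (h n) x) ^ 2) := by
    intro n
    rw [chargeVec, norm_smul, Complex.norm_I, one_mul, ← integral_const_mul]
    refine ((isTest_schwartz (derivTest (s / Real.sqrt Real.pi) (h n)).1).norm_phiVec_sq_le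
      hm).trans_eq ?_
    simp_rw [derivTest_apply, mul_pow]
  have h2 : Tendsto (fun n => ‖chargeVec m s (h n)‖ ^ 2) atTop (𝓝 0) :=
    squeeze_zero (fun n => by positivity) h1
      (by simpa using (hh.slope.const_mul ((s / Real.sqrt Real.pi) ^ 2)).const_mul (2 * m)⁻¹)
  rw [tendsto_zero_iff_norm_tendsto_zero]
  have h3 := h2.sqrt
  simpa [Real.sqrt_sq] using h3

/-- After integration by parts `g'` lives on the two transition regions. The right one lies outside
the support of `h`, while on the left one `h = 1` and `g` rises from `0` to `1`. -/
lemma IsDipoleProfile.integral_deriv_mul {ε R r : ℝ} (hε : 0 < ε) {g : ℝ → ℝ}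
    (hg : IsDipoleProfile ε R g) {h : 𝓢(ℝ, ℝ)} (h1 : ∀ x, |x| ≤ ε → h x = 1)
    (h0 : ∀ x, r < |x| → h x = 0) (hr : r < R) (hR : 0 < R) :
    ∫ x, deriv h x * g x = -1 := by
  have hneg : ∀ x < -ε, deriv g x = 0 := fun x hx => by
    have : g =ᶠ[𝓝 x] fun _ => 0 := by
      filter_upwards [Iio_mem_nhds hx] with y hy using hg.eq_zero y (Or.inl (le_of_lt hy))
    rw [this.deriv_eq, deriv_const]
  have hpos : ∀ x, 0 < x → x < R → deriv g x = 0 := fun x hx hx' => by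
    have : g =ᶠ[𝓝 x] fun _ => 1 := by
      filter_upwards [Ioo_mem_nhds hx hx'] with y hy using hg.eq_one y hy.1.le hy.2.le
    rw [this.deriv_eq, deriv_const]
  have hind : (fun x => h x * deriv g x) = (Set.Icc (-ε) 0).indicator (deriv g) := by
    ext x
    by_cases hx : x ∈ Set.Icc (-ε) 0
    · rw [Set.indicator_of_mem hx, h1 x (abs_le.2 ⟨hx.1, hx.2.trans hε.le⟩), one_mul]
    · rw [Set.indicator_of_notMem hx]
      rcases lt_or_ge x (-ε) with h2 | h2
      · rw [hneg x h2, mul_zero]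
      · have h3 : 0 < x := by
          by_contra! h4
          exact hx ⟨h2, h4⟩
        rcases lt_or_ge x R with h4 | h4
        · rw [hpos x h3 h4, mul_zero]
        · rw [h0 x (by rw [abs_of_pos h3]; linarith), zero_mul]
  have hint : ∫ x, h x * deriv g x = 1 := by
    rw [hind, integral_indicator measurableSet_Icc, integral_Icc_eq_integral_Ioc,
      ← intervalIntegral.integral_of_le (by linarith),
      intervalIntegral.integral_deriv_eq_sub
        (fun x _ => hg.contDiff.differentiable (by norm_num) x)
        ((hg.contDiff.continuous_deriv le_rfl).intervalIntegrable _ _),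
      hg.eq_one 0 le_rfl hR.le, hg.eq_zero (-ε) (Or.inl le_rfl), sub_zero]
  have := integral_neg_deriv_mul (isDiffTest_schwartz h) hg.isDiffTest
  rw [hint] at this
  simp_rw [neg_mul] at this
  rw [integral_neg] at this
  linarith

/-- The `√π` of the dipole cancels the `1/√π` of the charge density, so the phase corresponds to
exactly one unit of charge. -/
lemma chargeVec_symplectic {m : ℝ} (hm : 0 < m) (s : ℝ) (h : 𝓢(ℝ, ℝ)) {g : ℝ → ℝ}
    (hg : IsDiffTest g) (hint : ∫ x, deriv h x * g x = -1) :
    ⟪(Complex.I * (Real.sqrt Real.pi : ℝ)) • piVec m g, chargeVec m s h⟫ -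
      ⟪chargeVec m s h, (Complex.I * (Real.sqrt Real.pi : ℝ)) • piVec m g⟫ = Complex.I * s := by
  have h1 : ⟪phiVec m (derivTest (s / Real.sqrt Real.pi) h).1, piVec m g⟫ =
      -(Complex.I / 2 * ((s / Real.sqrt Real.pi : ℝ) : ℂ)) := by
    rw [inner_phiVec_piVec hm (isTest_schwartz _) hg]
    simp_rw [derivTest_apply, mul_assoc]
    rw [integral_const_mul, hint]
    push_cast
    ring
  have h2 : ⟪piVec m g, phiVec m (derivTest (s / Real.sqrt Real.pi) h).1⟫ =
      Complex.I / 2 * ((s / Real.sqrt Real.pi : ℝ) : ℂ) := by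
    rw [← inner_conj_symm, h1, map_neg, map_mul, map_div₀, Complex.conj_I, Complex.conj_ofReal,
      Complex.conj_ofNat]
    ring
  have h3 : (Real.sqrt Real.pi : ℂ) ≠ 0 := by
    exact_mod_cast (Real.sqrt_pos.2 Real.pi_pos).ne'
  rw [chargeVec, inner_smul_left, inner_smul_right, inner_smul_left, inner_smul_right, h1, h2]
  simp only [map_mul, Complex.conj_I, Complex.conj_ofReal]
  push_cast
  field_simp
  linear_combination (-2 * (s : ℂ)) * Complex.I_sq

/-- Commuting the charge operator through the dipole operator extracts the phase `exp(i s)`; the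
isometry left in front drops out of the norm. The right side no longer involves `g`, hence is
uniform in `R`. -/
lemma norm_expCharge_dipole {m : ℝ} (hm : 0 < m) (s : ℝ) (h : 𝓢(ℝ, ℝ)) {g : ℝ → ℝ}
    (hg : IsDiffTest g) (hint : ∫ x, deriv h x * g x = -1) :
    ‖weyl (chargeVec m s h) (dipole m g) - Complex.exp (Complex.I * s) • dipole m g‖ =
      ‖weyl (chargeVec m s h) vacuum - vacuum‖ := by
  rw [dipole_eq, ← mul_apply_eq_comp, weyl_mul_comm, chargeVec_symplectic hm s h hg hint,
    smul_apply, ← smul_sub, mul_apply_eq_comp, ← map_sub, norm_smul, norm_weyl_apply,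
    Complex.norm_exp]
  simp

/-! ### Weak-* limit points of the dipole states -/

lemma norm_dipole (m : ℝ) (g : ℝ → ℝ) : ‖dipole m g‖ = 1 := by
  rw [dipole_eq, norm_weyl_apply, norm_vacuum]

lemma vectorState_apply (m : ℝ) (ψ : Fock) (A : weylAlgebra m) :
    vectorState m ψ A = ⟪ψ, (A : Fock →L[ℂ] Fock) ψ⟫ := rfl

lemma norm_inner_dipole_le (m : ℝ) (g : ℝ → ℝ) (A : weylAlgebra m) (ψ : Fock) :
    ‖⟪dipole m g, (A : Fock →L[ℂ] Fock) ψ⟫‖ ≤ ‖A‖ * ‖ψ‖ := by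
  refine (norm_inner_le_norm _ _).trans ?_
  rw [norm_dipole, one_mul]
  exact ContinuousLinearMap.le_opNorm (A : Fock →L[ℂ] Fock) ψ

/-- Banach–Alaoglu: vector states of unit vectors lie in the weak-* compact unit ball. -/
lemma exists_mapClusterPt_vectorState (m : ℝ) (g : ℝ → ℝ → ℝ) :
    ∃ ω : WeakDual ℂ (weylAlgebra m),
      MapClusterPt ω atTop (fun R : ℝ => vectorState m (dipole m (g R))) := by
  obtain ⟨ω, -, hω⟩ := (WeakDual.isCompact_closedBall
    (0 : StrongDual ℂ (weylAlgebra m)) 1).exists_mapClusterPt (f := atTop)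
    (u := fun R : ℝ => vectorState m (dipole m (g R))) (by
      rw [le_principal_iff, mem_map]
      refine Eventually.of_forall fun R => ?_
      rw [Set.mem_preimage, mem_closedBall_zero_iff]
      refine ContinuousLinearMap.opNorm_le_bound _ zero_le_one fun A => ?_
      simpa [norm_dipole] using! norm_inner_dipole_le m (g R) A (dipole m (g R)))
  exact ⟨ω, hω⟩

lemma isState_of_mapClusterPt {m : ℝ} {g : ℝ → ℝ → ℝ} {ω : WeakDual ℂ (weylAlgebra m)}
    (hω : MapClusterPt ω atTop (fun R : ℝ => vectorState m (dipole m (g R)))) : IsState ω := by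
  refine ⟨?_, fun A => ?_⟩
  · refine IsClosed.mem_of_mapClusterPt (s := {ω : WeakDual ℂ (weylAlgebra m) | ω 1 = 1})
      (isClosed_eq (WeakDual.eval_continuous _) continuous_const) hω
      (Eventually.of_forall fun R => ?_)
    rw [Set.mem_ofPred_eq, vectorState_apply, OneMemClass.coe_one, one_apply_eq_self,
      inner_self_eq_norm_sq_to_K, norm_dipole]
    simp
  · have hc : IsClosed {ω : WeakDual ℂ (weylAlgebra m) |
        0 ≤ (ω (star A * A)).re ∧ (ω (star A * A)).im = 0} := by
      have h := WeakDual.eval_continuous (𝕜 := ℂ) (star A * A)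
      exact (isClosed_le continuous_const (Complex.continuous_re.comp h)).inter
        (isClosed_eq (Complex.continuous_im.comp h) continuous_const)
    have h := hc.mem_of_mapClusterPt hω (Eventually.of_forall fun R => by
      have : vectorState m (dipole m (g R)) (star A * A) =
          ((‖(A : Fock →L[ℂ] Fock) (dipole m (g R))‖ ^ 2 : ℝ) : ℂ) := by
        rw [vectorState_apply, MulMemClass.coe_mul, StarMemClass.coe_star, mul_apply_eq_comp,
          ContinuousLinearMap.star_eq_adjoint, ContinuousLinearMap.adjoint_inner_right,
          inner_self_eq_norm_sq_to_K]
        push_cast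
        rfl
      rw [Set.mem_ofPred_eq, this, Complex.ofReal_re, Complex.ofReal_im]
      exact ⟨by positivity, rfl⟩)
    exact ⟨_, h.1, Complex.ext rfl (by simpa using h.2)⟩

/-- The charge operator is first moved to the right past `B`, at vanishing cost in norm, and is then
compared with the scalar `exp(i s)` on the dipole vectors. The second bound depends on `n` only, so
it holds for every limit point. -/
lemma hasCharge_of_mapClusterPt {m ε : ℝ} (hm : 0 < m) (hε : 0 < ε) {g : ℝ → ℝ → ℝ}
    (hg : ∀ R > 0, IsDipoleProfile ε R (g R)) {ω : WeakDual ℂ (weylAlgebra m)}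
    (hω : MapClusterPt ω atTop (fun R : ℝ => vectorState m (dipole m (g R)))) :
    HasCharge ω 1 := by
  intro h hh s A B
  set z : ℂ := Complex.exp (Complex.I * s)
  have hu := hh.tendsto_chargeVec hm s
  have h1 : Tendsto (fun n => ω (star A * (expCharge m s (h n) * B - B * expCharge m s (h n))))
      atTop (𝓝 0) := by
    have h2 : Tendsto (fun n => expCharge m s (h n) * B - B * expCharge m s (h n)) atTop (𝓝 0) := by
      rw [tendsto_subtype_rng]
      have := asympCommutes_of_mem B.2 _ hu
      simpa [coe_expCharge] using this
    have h3 : Continuous fun C => ω (star A * C) := (map_continuous ω).comp (by fun_prop)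
    simpa [Function.comp_def] using (h3.tendsto 0).comp h2
  have h2 : Tendsto (fun n => ω (star A * B * (expCharge m s (h n) - algebraMap ℂ _ z)))
      atTop (𝓝 0) := by
    have hb := (tendsto_weyl_vacuum hu).const_mul ‖star A * B‖
    rw [mul_zero] at hb
    refine squeeze_zero_norm' ?_ hb
    filter_upwards [hh.eq_one ε] with n hn
    have hc : IsClosed {ω : WeakDual ℂ (weylAlgebra m) |
        ‖ω (star A * B * (expCharge m s (h n) - algebraMap ℂ _ z))‖ ≤
          ‖star A * B‖ * ‖weyl (chargeVec m s (h n)) vacuum - vacuum‖} :=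
      isClosed_le (WeakDual.eval_continuous _).norm continuous_const
    -- Here `n` is fixed and `R` grows past the support of `h n`; the bound is a weak-* closed
    -- condition on the functional.
    refine hc.mem_of_mapClusterPt hω ?_
    obtain ⟨r, hr⟩ := (hh.compact n).isCompact.isBounded.exists_norm_le
    filter_upwards [eventually_gt_atTop r, eventually_gt_atTop 0] with R hrR hR
    have hint := (hg R hR).integral_deriv_mul hε hn (r := r) (fun x hx => by
      by_contra hne
      exact absurd (hr x (subset_tsupport _ hne)) (not_le.2 hx)) hrR hR
    rw [← norm_expCharge_dipole hm s (h n) (hg R hR).isDiffTest hint]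
    have hsub : ((expCharge m s (h n) - algebraMap ℂ (weylAlgebra m) z : weylAlgebra m) :
        Fock →L[ℂ] Fock) (dipole m (g R)) =
        weyl (chargeVec m s (h n)) (dipole m (g R)) - z • dipole m (g R) := by
      rw [AddSubgroupClass.coe_sub, coe_expCharge]
      rfl
    rw [vectorState_apply, MulMemClass.coe_mul, mul_apply_eq_comp, hsub]
    exact norm_inner_dipole_le m (g R) (star A * B) _
  have h3 := (h1.add h2).add_const (z * ω (star A * B))
  rw [add_zero, zero_add] at h3
  simp only [Complex.ofReal_one, mul_one]
  refine h3.congr fun n => ?_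
  have h4 : star A * expCharge m s (h n) * B =
      star A * (expCharge m s (h n) * B - B * expCharge m s (h n)) +
        star A * B * (expCharge m s (h n) - algebraMap ℂ _ z) + z • (star A * B) := by
    rw [Algebra.smul_def, Algebra.commutes]
    noncomm_ring
  rw [h4, map_add, map_add, map_smul, smul_eq_mul]

end

end Schwinger

open Schwinger
theorem proposition5p1
    (e : ℝ) (he : 0 < e) (m : ℝ) (hm : m = e / Real.sqrt Real.pi)
    (ε : ℝ) (hε : 0 < ε)
    (g : ℝ → ℝ → ℝ) (hg : ∀ R > 0, IsDipoleProfile ε R (g R)) :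
    (∀ R > 0,
      energyForm m (dipole m (g R)) =
        ENNReal.ofReal
          (Real.pi / 2 * ∫ x, ((deriv (g R) x) ^ 2 + e ^ 2 / Real.pi * (g R x) ^ 2)) ∧
      ∃ E : ℝ → ℝ, (∀ x, HasEnergyDensity m (dipole m (g R)) x (E x)) ∧ Integrable E ∧
        ∫ x, E x =
          Real.pi / 2 * ∫ x, ((deriv (g R) x) ^ 2 + e ^ 2 / Real.pi * (g R x) ^ 2)) ∧
    (∃ ω : WeakDual ℂ (weylAlgebra m),
      MapClusterPt ω atTop (fun R : ℝ => vectorState m (dipole m (g R)))) ∧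
    (∀ ω : WeakDual ℂ (weylAlgebra m),
      MapClusterPt ω atTop (fun R : ℝ => vectorState m (dipole m (g R))) →
        IsState ω ∧ HasCharge ω 1) := by
  have hm0 : 0 < m := hm ▸ div_pos he (Real.sqrt_pos.2 Real.pi_pos)
  have hm2 : e ^ 2 / Real.pi = m ^ 2 := by
    rw [hm, div_pow, Real.sq_sqrt Real.pi_pos.le]
  rw [hm2]
  refine ⟨fun R hR => ?_, exists_mapClusterPt_vectorState m g, fun ω hω =>
    ⟨isState_of_mapClusterPt hω, hasCharge_of_mapClusterPt hm0 hε hg hω⟩⟩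
  have ht := (hg R hR).isDiffTest
  refine ⟨energyForm_dipole hm0 ht, _,
    hasEnergyDensity_dipole hm0 ht (hg R hR).contDiff, ?_, integral_const_mul _ _⟩
  exact (ht.isTest_deriv.memLp.integrable_sq.add
    (ht.isTest.memLp.integrable_sq.const_mul _)).const_mul _
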